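/- **Setting.** Let $k\ge 0$. For a function $f:\mathbb Z^2\to\mathbb C$ of $(l,m)$ write $\bar f=f(l+1,m)$, $\hat f=f(l,m+1)$ and $\overset{h}{f}=f(l,m+h)$. Consider the matrices $$L_k=\begin{pmatrix}\sum_{i=0}^k a_i\nu^{2i}&\sum_{i=0}^k b_i\nu^{2i+1}\\ \sum_{i=0}^k c_i\nu^{2i+1}&\sum_{i=0}^k d_i\nu^{2i}\end{pmatrix},\qquad M=\begin{pmatrix}1&\beta\nu\\ \gamma\nu&1\end{pmatrix},$$ where $a_i,b_i,c_i,d_i,\beta,\gamma:\mathbb Z^2\to\mathbb C$. The pair $(L_k,M)$ is *compatible* if $\widehat{L_k}\,M=\overline{M}\,L_k$ for all $(l,m)\in\mathbb Z^2$ and all $\nu\in\mathbb C$. **(1) Parametrisation.** If $\beta,\gamma,b_k,c_k$ vanish nowhere and $(L_k,M)$ is compatible, then there are nowhere vanishing $x,y:\mathbb Z^2\to\mathbb C$ with $$\beta=y/\hat x,\quad \gamma=x/\hat y,\quad b_k=y/\bar x,\quad c_k=x/\bar y.\tag{P}$$ From now on let $x,y:\mathbb Z^2\to\mathbb C$ be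 nowhere vanishing, let $\beta,\gamma$ be given by (P), and consider only those $L_k$ which satisfy (P) and the gauge $a_0=d_0=1$. Consider the system $$\frac{\hat{\bar x}}{\overset{2k+1}{x}}+\frac{\overset{2k+1}{y}}{\overset{2k}{y}}=\frac{\hat{\bar x}}{\bar x}+\frac{\bar y}{\overset{2k}{y}},\qquad \frac{\hat{\bar y}}{\overset{2k+1}{y}}+\frac{\overset{2k+1}{x}}{\overset{2k}{x}}=\frac{\hat{\bar y}}{\bar y}+\frac{\bar x}{\overset{2k}{x}}\tag{E$_k$}$$ on $\mathbb Z^2$, the functions $$\alpha_k(x,y)=\frac{x}{\overset{2k}{x}}+\frac{x}{\bar x}\sum_{j=1}^k\left(\frac{\overset{2j}{y}}{\overset{2j-1}{y}}+\frac{\overset{2j-1}{x}}{\overset{2j-2}{x}}\right),$$ and the genericity conditions (both empty for $k=0$) * (G) $\bar\beta\bar\gamma\ne\overset{h}{(\beta\gamma)}$ for all $0\le h<2k$, at every $(l,m)$; * (D) $\overset{g}{(\beta\gamma)}\neq\overset{h}{(\beta\gamma)}$ for all $0\le g<h\le 2k-2$, at every $(l,m)$. **(2) Sheared lattice.** $(x,y)$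 solves (E$_k$) if and only if $X(l,m)=x(l,m-2kl)$, $Y(l,m)=y(l,m-2kl)$ solve (E$_0$), which is LMKdV$_2$: $$\frac{\hat{\bar X}}{\hat X}+\frac{\hat Y}{Y}=\frac{\hat{\bar X}}{\bar X}+\frac{\bar Y}{Y},\qquad \frac{\hat{\bar Y}}{\hat Y}+\frac{\hat X}{X}=\frac{\hat{\bar Y}}{\bar Y}+\frac{\bar X}{X}.$$ **(3) Equivalence, top coefficients.** If $(x,y)$ solves (E$_k$), then there is an $L_k$ such that $(L_k,M)$ is compatible, with $a_k=\alpha_k(x,y)$ and $d_k=\alpha_k(y,x)$. If (G) holds, then there is an $L_k$ such that $(L_k,M)$ is compatible if and only if $(x,y)$ solves (E$_k$); such an $L_k$ is unique, and it has $a_k=\alpha_k(x,y)$, $d_k=\alpha_k(y,x)$. **(4) Reconstruction.** Put $\varphi_i=(b_i,c_i)^T$, $\psi_i=(a_i,d_i)^T$ and $\Psi_k=(\varphi_0,\psi_1,\varphi_1,\dots,\psi_{k-1},\varphi_{k-1},\psi_k)^T$ (empty if $k=0$). Let $Z_k\Psi_k=C_k$ be the block upper triangular linear system, with $2\times2$ blocks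 and identity matrices on the diagonal, that consists of $$\varphi_i+\sum_{j=i+1}^{k}S_i^{(j)}\psi_j+\sum_{j=i+1}^{k-1}T_i^{(j)}\varphi_j=B_i-T_i^{(k)}\varphi_k\quad(0\le i<k),$$ $$\psi_i+P_i\varphi_i+\sum_{j=i+1}^{k}Q_i^{(j)}\psi_j+\sum_{j=i+1}^{k-1}R_i^{(j)}\varphi_j=A_i-R_i^{(k)}\varphi_k\quad(1\le i<k),\qquad \psi_k=A_k-P_k\varphi_k .$$ Here $\varphi_k=(y/\bar x,x/\bar y)^T$, the matrices $P_i,Q_i^{(j)},R_i^{(j)},S_i^{(j)},T_i^{(j)}$ are diagonal, and the $[1,1]$ elements and first components are, with $w_h=\overset{h}{(\beta\gamma)}$, $$A_i=\prod_{j=1}^i\overset{2j-2}{\gamma}\,\overset{2j-1}{\beta},\quad B_i=\beta\prod_{j=1}^i\overset{2j-1}{\gamma}\,\overset{2j}{\beta},\quad P_i=-\sum_{j=1}^i\left(\frac{\overset{2j-2}{\gamma}}{\overset{2j-1}{\gamma}}+1\right)\frac1\beta\prod_{h=1}^{j-1}\frac{\overset{2h-2}{\gamma}\,\overset{2h-1}{\beta}}{\overset{2h-1}{\gamma}\,\overset{2h}{\beta}},$$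 $$S_i^{(j)}=-\sum_{h=0}^{2i}\frac{U_i^{(h)}w_h}{w_h^{\,j}}\sum_{g=0}^i\xi_{2i}^{(2g)}w_h^g,\quad T_i^{(j)}=\sum_{h=0}^{2i}\frac{U_i^{(h)}}{w_h^{\,j}}\sum_{g=0}^i\eta_{2i}^{(2g)}w_h^g,$$ $$Q_i^{(j)}=-\sum_{h=0}^{2i-1}\frac{V_i^{(h)}}{w_h^{\,j}}\sum_{g=0}^i\eta_{2i-1}^{(2g)}w_h^g,\quad R_i^{(j)}=\sum_{h=0}^{2i-1}\frac{V_i^{(h)}}{w_h^{\,j}}\sum_{g=0}^{i}\xi_{2i-1}^{(2g)}w_h^g,$$ $$U_i^{(h)}=\frac{w_h^{\,i-1}B_i}{\prod_{0\le g\le 2i,\,g\ne h}(w_g-w_h)},\qquad V_i^{(h)}=\frac{w_h^{\,i-1}A_i}{\prod_{0\le g\le 2i-1,\,g\ne h}(w_h-w_g)},$$ where $\xi_a^{(b)}$ (respectively $\eta_a^{(b)}$) is the sum over $a\ge h_1>h_2>\dots>h_n\ge0$ of the alternating products $\overset{h_1}{\gamma}\,\overset{h_2}{\beta}\,\overset{h_3}{\gamma}\cdots$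 of $n$ factors, with $n=a-b$ (respectively $n=a-b+1$); it is $1$ if $n=0$ and $0$ if $n<0$. The $[2,2]$ elements and second components are obtained by interchanging $\beta$ and $\gamma$. Assume (D). Then at every $(l,m)$ the system $Z_k\Psi_k=C_k$ has exactly one solution, so it determines exactly one $L_k$ (subject to (P) and $a_0=d_0=1$). For this $L_k$, the pair $(L_k,M)$ is compatible if and only if $(x,y)$ solves (E$_k$). If also (G) holds, then every $L_k$ for which $(L_k,M)$ is compatible satisfies $Z_k\Psi_k=C_k$. -/

import Mathlib

open Finset Matrix

noncomputable section

namespace LMKdV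

/-- Complex functions on the lattice of points `(l, m)`. The bar shift is `l ↦ l + 1`, the hat shift
is `m ↦ m + 1`. -/
abbrev Field2 := ℤ → ℤ → ℂ

/-- The function vanishes at no lattice point. -/
def NowhereZero (f : Field2) : Prop := ∀ l m, f l m ≠ 0

/-! ### Lax pairs -/

/-- The coefficient functions `a_i, b_i, c_i, d_i`, `0 ≤ i ≤ k`, of the matrix `L_k`. -/
@[ext] structure LaxCoeffs (k : ℕ) where
  a : Fin (k + 1) → Field2
  b : Fin (k + 1) → Field2
  c : Fin (k + 1) → Field2
  d : Fin (k + 1) → Field2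

/-- The matrix `L_k`, polynomial in the spectral parameter `ν`. -/
def Lmat {k : ℕ} (X : LaxCoeffs k) (l m : ℤ) (ν : ℂ) : Matrix (Fin 2) (Fin 2) ℂ :=
  !![∑ i, X.a i l m * ν ^ (2 * (i : ℕ)), ∑ i, X.b i l m * ν ^ (2 * (i : ℕ) + 1);
     ∑ i, X.c i l m * ν ^ (2 * (i : ℕ) + 1), ∑ i, X.d i l m * ν ^ (2 * (i : ℕ))]

/-- The matrix `M`. -/
def Mmat (β γ : Field2) (l m : ℤ) (ν : ℂ) : Matrix (Fin 2) (Fin 2) ℂ :=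
  !![1, β l m * ν; γ l m * ν, 1]

/-- The compatibility condition `L̂ M = M̄ L`, identically in the spectral parameter. -/
def Compatible {k : ℕ} (β γ : Field2) (X : LaxCoeffs k) : Prop :=
  ∀ (l m : ℤ) (ν : ℂ), Lmat X l (m + 1) ν * Mmat β γ l m ν = Mmat β γ (l + 1) m ν * Lmat X l m ν

/-- `β = y / x̂`. -/
def betaOf (x y : Field2) : Field2 := fun l m => y l m / x l (m + 1)

/-- `γ = x / ŷ`. -/
def gammaOf (x y : Field2) : Field2 := fun l m => x l m / y l (m + 1)

/-- `y / x̄`, the top coefficient `b_k`. -/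
def topB (x y : Field2) : Field2 := fun l m => y l m / x (l + 1) m

/-- `x / ȳ`, the top coefficient `c_k`. -/
def topC (x y : Field2) : Field2 := fun l m => x l m / y (l + 1) m

/-- The gauge `a_0 = d_0 = 1` and the parametrisation `b_k = y / x̄`, `c_k = x / ȳ`. -/
structure Admissible {k : ℕ} (x y : Field2) (X : LaxCoeffs k) : Prop where
  a_zero : ∀ l m, X.a 0 l m = 1
  d_zero : ∀ l m, X.d 0 l m = 1
  b_top : X.b (Fin.last k) = topB x y
  c_top : X.c (Fin.last k) = topC x y

/-- `(L_k, M)` is a Lax pair with dependent variables `x, y`. -/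
def IsLaxPair {k : ℕ} (x y : Field2) (X : LaxCoeffs k) : Prop :=
  Admissible x y X ∧ Compatible (betaOf x y) (gammaOf x y) X

/-! ### The nonlinear systems -/

/-- The coupled system of the `k`-th member of the hierarchy. -/
def IsSolution (k : ℕ) (x y : Field2) : Prop :=
  ∀ l m : ℤ,
    (x (l + 1) (m + 1) / x l (m + (2 * k + 1)) + y l (m + (2 * k + 1)) / y l (m + 2 * k)
      = x (l + 1) (m + 1) / x (l + 1) m + y (l + 1) m / y l (m + 2 * k)) ∧
    (y (l + 1) (m + 1) / y l (m + (2 * k + 1)) + x l (m + (2 * k + 1)) / x l (m + 2 * k)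
      = y (l + 1) (m + 1) / y (l + 1) m + x (l + 1) m / x l (m + 2 * k))

/-- The two-component lattice modified KdV system LMKdV₂. -/
def IsLMKdV2 (x y : Field2) : Prop :=
  ∀ l m : ℤ,
    (x (l + 1) (m + 1) / x l (m + 1) + y l (m + 1) / y l m
      = x (l + 1) (m + 1) / x (l + 1) m + y (l + 1) m / y l m) ∧
    (y (l + 1) (m + 1) / y l (m + 1) + x l (m + 1) / x l m
      = y (l + 1) (m + 1) / y (l + 1) m + x (l + 1) m / x l m)

/-- Restriction of a function to the sheared lattice. -/
def shear (k : ℕ) (f : Field2) : Field2 := fun l m => f l (m - 2 * k * l)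

/-- The formula for the top coefficient `a_k`; the one for `d_k` has `x` and `y` interchanged. -/
def topA (k : ℕ) (x y : Field2) : Field2 := fun l m =>
  x l m / x l (m + 2 * k) + x l m / x (l + 1) m *
    ∑ j ∈ Icc 1 k, (y l (m + 2 * j) / y l (m + 2 * j - 1)
      + x l (m + 2 * j - 1) / x l (m + 2 * j - 2))

/-! ### Genericity -/

/-- `β̄ γ̄` differs from the `h`-fold `m`-shift of `β γ` for `0 ≤ h < 2 k`. -/
def NonResonant (k : ℕ) (β γ : Field2) : Prop :=
  ∀ (l m : ℤ) (h : ℕ), h < 2 * k → β (l + 1) m * γ (l + 1) m ≠ β l (m + h) * γ l (m + h)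

/-- The `m`-shifts `0, 1, …, 2 k - 2` of `β γ` are pairwise different. -/
def ShiftDistinct (k : ℕ) (β γ : Field2) : Prop :=
  ∀ (l m : ℤ) (g h : ℕ), g < h → h + 2 ≤ 2 * k →
    β l (m + g) * γ l (m + g) ≠ β l (m + h) * γ l (m + h)

/-! ### The linear system `Z_k Ψ_k = C_k`

In this part `u h` and `v h` stand for the `h`-fold `m`-shifts of `β` and `γ` at a given lattice
point. Each scalar function below is a `[1,1]` element (or a first component); the `[2,2]` element
(second component) has `u` and `v` interchanged. -/

/-- The sequence of `m`-shifts of `f` at `(l, m)`. -/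
def shifts (f : Field2) (l m : ℤ) : ℕ → ℂ := fun h => f l (m + h)

/-- `∑ u h₁ * v h₂ * u h₃ * ⋯` (`n` alternating factors) over all `N > h₁ > h₂ > ⋯ > hₙ ≥ 0`. -/
def cascade : (n N : ℕ) → (u v : ℕ → ℂ) → ℂ
  | 0, _, _, _ => 1
  | n + 1, N, u, v => ∑ h ∈ range N, u h * cascade n h v u

/-- `ξ_a^{(b)}`, with first factor `u`; it is `0` for `a < b`. -/
def xi (a b : ℕ) (u v : ℕ → ℂ) : ℂ := if b ≤ a then cascade (a - b) (a + 1) u v else 0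

/-- `η_a^{(b)}`, with first factor `u` (for `b ≤ a + 1`). -/
def eta (a b : ℕ) (u v : ℕ → ℂ) : ℂ := cascade (a + 1 - b) (a + 1) u v

def coefA (i : ℕ) (u v : ℕ → ℂ) : ℂ := ∏ j ∈ range i, (v (2 * j) * u (2 * j + 1))

def coefB (i : ℕ) (u v : ℕ → ℂ) : ℂ := u 0 * ∏ j ∈ range i, (v (2 * j + 1) * u (2 * j + 2))

def coefP (i : ℕ) (u v : ℕ → ℂ) : ℂ :=
  -∑ j ∈ range i, (v (2 * j) / v (2 * j + 1) + 1) * (1 / u 0) *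
    ∏ h ∈ range j, (v (2 * h) * u (2 * h + 1)) / (v (2 * h + 1) * u (2 * h + 2))

def coefU (i h : ℕ) (u v : ℕ → ℂ) : ℂ :=
  (u h * v h) ^ ((i : ℤ) - 1) * coefB i u v /
    ∏ g ∈ (range (2 * i + 1)).erase h, (u g * v g - u h * v h)

def coefV (i h : ℕ) (u v : ℕ → ℂ) : ℂ :=
  (u h * v h) ^ ((i : ℤ) - 1) * coefA i u v /
    ∏ g ∈ (range (2 * i)).erase h, (u h * v h - u g * v g)

def coefS (i j : ℕ) (u v : ℕ → ℂ) : ℂ :=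
  ∑ h ∈ range (2 * i + 1), -(coefU i h u v * (u h * v h) *
    ∑ g ∈ range (i + 1), xi (2 * i) (2 * g) v u * (u h * v h) ^ g) / (u h * v h) ^ j

def coefT (i j : ℕ) (u v : ℕ → ℂ) : ℂ :=
  ∑ h ∈ range (2 * i + 1), (coefU i h u v *
    ∑ g ∈ range (i + 1), eta (2 * i) (2 * g) v u * (u h * v h) ^ g) / (u h * v h) ^ j

def coefQ (i j : ℕ) (u v : ℕ → ℂ) : ℂ :=
  ∑ h ∈ range (2 * i), -(coefV i h u v *
    ∑ g ∈ range (i + 1), eta (2 * i - 1) (2 * g) v u * (u h * v h) ^ g) / (u h * v h) ^ j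

def coefR (i j : ℕ) (u v : ℕ → ℂ) : ℂ :=
  ∑ h ∈ range (2 * i), (coefV i h u v *
    ∑ g ∈ range (i + 1), xi (2 * i - 1) (2 * g) v u * (u h * v h) ^ g) / (u h * v h) ^ j

/-- The diagonal `2 × 2` matrix with `[1,1]` element `f u v` and `[2,2]` element `f v u`. -/
def diagSym (f : (ℕ → ℂ) → (ℕ → ℂ) → ℂ) (u v : ℕ → ℂ) : Matrix (Fin 2) (Fin 2) ℂ :=
  !![f u v, 0; 0, f v u]

/-- The vector with first component `f u v` and second component `f v u`. -/
def vecSym (f : (ℕ → ℂ) → (ℕ → ℂ) → ℂ) (u v : ℕ → ℂ) : Fin 2 → ℂ := ![f u v, f v u]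

/-- The `(p, q)` block of `Z_k`. Blocks are numbered from `0` in the order
`φ_0, ψ_1, φ_1, …, ψ_{k-1}, φ_{k-1}, ψ_k`: number `2 i` belongs to `φ_i`, number `2 i - 1` to
`ψ_i`. -/
def Zblock (u v : ℕ → ℂ) (p q : ℕ) : Matrix (Fin 2) (Fin 2) ℂ :=
  if q < p then 0
  else if p = q then 1
  else if p % 2 = 0 then
    if q % 2 = 1 then diagSym (coefS (p / 2) ((q + 1) / 2)) u v
    else diagSym (coefT (p / 2) (q / 2)) u v
  else
    if q = p + 1 then diagSym (coefP ((p + 1) / 2)) u v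
    else if q % 2 = 1 then diagSym (coefQ ((p + 1) / 2) ((q + 1) / 2)) u v
    else diagSym (coefR ((p + 1) / 2) (q / 2)) u v

/-- The matrix `Z_k`. -/
def Zmat (k : ℕ) (u v : ℕ → ℂ) : Matrix (Fin (2 * k) × Fin 2) (Fin (2 * k) × Fin 2) ℂ :=
  Matrix.of fun p q => Zblock u v p.1 q.1 p.2 q.2

/-- The `p`-th block of the right-hand side `C_k`, where `w` stands for `φ_k`. -/
def Cblock (k : ℕ) (u v : ℕ → ℂ) (w : Fin 2 → ℂ) (p : ℕ) : Fin 2 → ℂ :=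
  if p % 2 = 0 then vecSym (coefB (p / 2)) u v - diagSym (coefT (p / 2) k) u v *ᵥ w
  else if (p + 1) / 2 < k then
    vecSym (coefA ((p + 1) / 2)) u v - diagSym (coefR ((p + 1) / 2) k) u v *ᵥ w
  else vecSym (coefA k) u v - diagSym (coefP k) u v *ᵥ w

/-- The right-hand side `C_k`. -/
def Cvec (k : ℕ) (u v : ℕ → ℂ) (w : Fin 2 → ℂ) : Fin (2 * k) × Fin 2 → ℂ :=
  fun p => Cblock k u v w p.1 p.2

/-- The matrix `Z_k` at the lattice point `(l, m)`, with `β = y / x̂`, `γ = x / ŷ`. -/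
def Zat (k : ℕ) (x y : Field2) (l m : ℤ) :
    Matrix (Fin (2 * k) × Fin 2) (Fin (2 * k) × Fin 2) ℂ :=
  Zmat k (shifts (betaOf x y) l m) (shifts (gammaOf x y) l m)

/-- The vector `C_k` at the lattice point `(l, m)`, with `φ_k = (y / x̄, x / ȳ)`. -/
def Cat (k : ℕ) (x y : Field2) (l m : ℤ) : Fin (2 * k) × Fin 2 → ℂ :=
  Cvec k (shifts (betaOf x y) l m) (shifts (gammaOf x y) l m) ![topB x y l m, topC x y l m]

/-- The vector `Ψ_k = (φ_0, ψ_1, φ_1, …, ψ_{k-1}, φ_{k-1}, ψ_k)` of the coefficients of `L_k`, where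
`φ_i = (b_i, c_i)` and `ψ_i = (a_i, d_i)`. -/
def PsiVec {k : ℕ} (X : LaxCoeffs k) (l m : ℤ) : Fin (2 * k) × Fin 2 → ℂ := fun p =>
  let i : Fin (k + 1) := ⟨((p.1 : ℕ) + 1) / 2, by omega⟩
  if (p.1 : ℕ) % 2 = 0 then ![X.b i l m, X.c i l m] p.2 else ![X.a i l m, X.d i l m] p.2

/-- The coefficients of `L_k` solve `Z_k Ψ_k = C_k` at every lattice point. -/
def Reconstructed {k : ℕ} (x y : Field2) (X : LaxCoeffs k) : Prop :=
  ∀ l m, Zat k x y l m *ᵥ PsiVec X l m = Cat k x y l m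

end LMKdV

end

noncomputable section

namespace LMKdV

open Polynomial

/-! ### Products of the matrices `M` -/

/-! Write `M_h` for the `h`-fold `m`-shift of `M`. Everything rests on one explicit matrix, `L = K
M_{2k-1} ⋯ M_0` with `K = [[1, p ν], [q ν, 1]]`; the choice of `p, q` that gives (P) is `leftEntry`,
and the coefficients of this `L` are `canonLax`. Both `L̂ M` and `M̄ L` then contain `M_{2k-1} ⋯
M_0` as right factor, so compatibility reduces to `K̂ M_{2k} = M̄ K`. The diagonal entries of this
agree automatically and the off-diagonal ones are the two equations (E_k) (`polyCompat_canon_iff`,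
`canonLax_compatible_iff`). No genericity enters here.

Under (G) no other `L` is possible. At `ν² = 1/(βγ)` the matrix `M` has a kernel vector `n`, and `M̄
L n = L̂ M n = 0` with `det M̄ ≠ 0`, so `L n = 0` and `L` is divisible by `M` on the right. The
quotient satisfies the same relation with `β, γ` shifted once, so `2k` factors split off
(`exists_right_quotient`). Comparing degrees after multiplication by the adjugate of `M_{2k-1} ⋯
M_0` shows that the entries of the remaining factor, taken in `ν²` as in `rowPoly`, are constants,
and the gauge and (P) fix these (`eq_canon`, `eq_canonLax`).

For the reconstruction, `det (M_{n-1} ⋯ M_0)` vanishes at `ν² = 1/w_h` for `h < n`. Since `L` has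
`M_{n-1} ⋯ M_0` as right factor, its product with the adjugate vanishes there too, which is one
linear relation on the coefficients of each row per node (`canon_eval_eq`). Lagrange weights at the
nodes `w_h` combine these relations into the rows of `Z_k`: `n = 2i + 1` gives the row of `φ_i` and
`n = 2i` that of `ψ_i`. Divided-difference identities make the unwanted entries vanish and the
diagonal ones equal to `1`. As `Z_k` is block unitriangular, its solution is this `L`, and the
remaining claims follow from the first two paragraphs.

The potentials `x, y` come from the top coefficients of the compatibility condition: these say that
the steps `(x, y) ↦ (y/β, x/γ)` in `m` and `(x, y) ↦ (y/b_k, x/c_k)` in `l` commute, so a common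
orbit exists on the whole lattice (`exists_potentials`). -/

/-- The first row `(E, ν O)` of `M_{N-1} ⋯ M_0`, where `M_h` has off-diagonal entries `u h * ν` and
`v h * ν`, as the pair of `E` and `O` in the variable `X = ν ^ 2`. -/
def rowPoly : ℕ → (ℕ → ℂ) → (ℕ → ℂ) → ℂ[X] × ℂ[X]
  | 0, _, _ => (1, 0)
  | N + 1, u, v =>
    ((rowPoly N u v).1 + C (u N) * X * (rowPoly N v u).2,
      (rowPoly N u v).2 + C (u N) * (rowPoly N v u).1)

/-- The diagonal entry `E` of `M_{N-1} ⋯ M_0`. -/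
def evenPoly (N : ℕ) (u v : ℕ → ℂ) : ℂ[X] := (rowPoly N u v).1

/-- The off-diagonal entry of `M_{N-1} ⋯ M_0`, divided by `ν`. -/
def oddPoly (N : ℕ) (u v : ℕ → ℂ) : ℂ[X] := (rowPoly N u v).2

@[simp] lemma evenPoly_zero (u v : ℕ → ℂ) : evenPoly 0 u v = 1 := rfl

@[simp] lemma oddPoly_zero (u v : ℕ → ℂ) : oddPoly 0 u v = 0 := rfl

lemma evenPoly_succ (N : ℕ) (u v : ℕ → ℂ) :
    evenPoly (N + 1) u v = evenPoly N u v + C (u N) * X * oddPoly N v u := rfl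

lemma oddPoly_succ (N : ℕ) (u v : ℕ → ℂ) :
    oddPoly (N + 1) u v = oddPoly N u v + C (u N) * evenPoly N v u := rfl

/-- Multiplication on the right by `M_0`. -/
lemma evenPoly_succ' (N : ℕ) (u v : ℕ → ℂ) :
    evenPoly (N + 1) u v = evenPoly N (fun h => u (h + 1)) (fun h => v (h + 1))
        + C (v 0) * X * oddPoly N (fun h => u (h + 1)) (fun h => v (h + 1)) ∧
      oddPoly (N + 1) u v = oddPoly N (fun h => u (h + 1)) (fun h => v (h + 1))
        + C (u 0) * evenPoly N (fun h => u (h + 1)) (fun h => v (h + 1)) := by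
  induction N generalizing u v with
  | zero => simp [evenPoly_succ, oddPoly_succ]
  | succ N ih =>
    constructor
    · rw [evenPoly_succ (N + 1), (ih u v).1, (ih v u).2, evenPoly_succ N, oddPoly_succ N]
      ring
    · rw [oddPoly_succ (N + 1), (ih u v).2, (ih v u).1, evenPoly_succ N, oddPoly_succ N]
      ring

/-- Split the chains according to whether their largest index is `N`. -/
lemma cascade_succ_succ (n N : ℕ) (u v : ℕ → ℂ) :
    cascade (n + 1) (N + 1) u v = cascade (n + 1) N u v + u N * cascade n N v u := by
  simp [cascade, sum_range_succ]

lemma cascade_succ_zero (n : ℕ) (u v : ℕ → ℂ) : cascade (n + 1) 0 u v = 0 := by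
  simp [cascade]

lemma cascade_eq_zero {n N : ℕ} (h : N < n) (u v : ℕ → ℂ) : cascade n N u v = 0 := by
  induction N generalizing n u v with
  | zero =>
    obtain ⟨n, rfl⟩ := Nat.exists_eq_succ_of_ne_zero (by omega : n ≠ 0)
    exact cascade_succ_zero n u v
  | succ N ih =>
    obtain ⟨n, rfl⟩ := Nat.exists_eq_succ_of_ne_zero (by omega : n ≠ 0)
    rw [cascade_succ_succ, ih (by omega), ih (by omega), mul_zero, add_zero]

/-- Expanding the product means choosing the factors that contribute an off-diagonal entry. These
entries alternate between `u` and `v`, and an even number of them lands on the diagonal. -/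
lemma coeff_evenPoly_oddPoly (N i : ℕ) (u v : ℕ → ℂ) :
    (evenPoly N u v).coeff i = cascade (2 * i) N u v ∧
      (oddPoly N u v).coeff i = cascade (2 * i + 1) N u v := by
  induction N generalizing i u v with
  | zero =>
    rcases i with _ | i
    · simp [cascade]
    · simp [cascade, show 2 * (i + 1) = 2 * i + 1 + 1 by ring, coeff_one]
  | succ N ih =>
    constructor
    · rcases i with _ | i
      · rw [evenPoly_succ, coeff_add, (ih 0 u v).1, mul_assoc, coeff_C_mul]
        simp [cascade]
      · rw [evenPoly_succ, coeff_add, (ih (i + 1) u v).1, mul_assoc, coeff_C_mul, coeff_X_mul,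
          (ih i v u).2, show 2 * (i + 1) = 2 * i + 1 + 1 by ring, cascade_succ_succ]
    · rw [oddPoly_succ, coeff_add, (ih i u v).2, coeff_C_mul, (ih i v u).1, cascade_succ_succ]

lemma coeff_evenPoly (N i : ℕ) (u v : ℕ → ℂ) :
    (evenPoly N u v).coeff i = cascade (2 * i) N u v := (coeff_evenPoly_oddPoly N i u v).1

lemma coeff_oddPoly (N i : ℕ) (u v : ℕ → ℂ) :
    (oddPoly N u v).coeff i = cascade (2 * i + 1) N u v := (coeff_evenPoly_oddPoly N i u v).2

lemma natDegree_evenPoly_le {N i : ℕ} (h : N < 2 * i + 2) (u v : ℕ → ℂ) :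
    (evenPoly N u v).natDegree ≤ i := by
  rw [natDegree_le_iff_coeff_eq_zero]
  intro j hj
  rw [coeff_evenPoly, cascade_eq_zero (by omega)]

lemma coeff_oddPoly_eq_zero {N i : ℕ} (h : N < 2 * i + 1) (u v : ℕ → ℂ) :
    (oddPoly N u v).coeff i = 0 := by
  rw [coeff_oddPoly, cascade_eq_zero h]

lemma natDegree_oddPoly_le {N i : ℕ} (h : N < 2 * i + 3) (u v : ℕ → ℂ) :
    (oddPoly N u v).natDegree ≤ i := by
  rw [natDegree_le_iff_coeff_eq_zero]
  intro j hj
  rw [coeff_oddPoly_eq_zero (by omega)]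

lemma evenPoly_coeff_zero (N : ℕ) (u v : ℕ → ℂ) : (evenPoly N u v).coeff 0 = 1 := by
  rw [coeff_evenPoly]; simp [cascade]

lemma evenPoly_ne_zero (N : ℕ) (u v : ℕ → ℂ) : evenPoly N u v ≠ 0 := fun h => by
  simpa [h] using evenPoly_coeff_zero N u v

/-- The determinant of `M_{N-1} ⋯ M_0`. -/
lemma det_rowPoly (N : ℕ) (u v : ℕ → ℂ) :
    evenPoly N u v * evenPoly N v u - X * oddPoly N u v * oddPoly N v u
      = ∏ h ∈ range N, (1 - C (u h * v h) * X) := by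
  induction N with
  | zero => simp
  | succ N ih =>
    rw [prod_range_succ, ← ih]
    simp only [evenPoly_succ, oddPoly_succ, C_mul]
    ring

/-! ### Full products -/

/-- Only one strictly decreasing chain uses all the available indices, so the sum is a single
product. -/
lemma cascade_diag (i : ℕ) (u v : ℕ → ℂ) :
    cascade (2 * i) (2 * i) u v = coefA i u v ∧
      cascade (2 * i + 1) (2 * i + 1) u v = u (2 * i) * coefA i v u := by
  induction i generalizing u v with
  | zero => simp [cascade, coefA]
  | succ i ih =>
    have h1 : ∀ u v : ℕ → ℂ, cascade (2 * (i + 1)) (2 * (i + 1)) u v = coefA (i + 1) u v := by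
      intro u v
      rw [show 2 * (i + 1) = 2 * i + 1 + 1 by ring, cascade_succ_succ, cascade_eq_zero (by omega),
        (ih v u).2, coefA, coefA, prod_range_succ]
      ring
    refine ⟨h1 u v, ?_⟩
    rw [cascade_succ_succ, cascade_eq_zero (by omega), h1 v u, zero_add]

lemma coefB_eq (i : ℕ) (u v : ℕ → ℂ) : coefB i u v = u (2 * i) * coefA i v u := by
  induction i with
  | zero => simp [coefA, coefB]
  | succ i ih =>
    have h1 : coefB (i + 1) u v = coefB i u v * (v (2 * i + 1) * u (2 * i + 2)) := by
      rw [coefB, coefB, prod_range_succ, mul_assoc]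
    rw [h1, ih, coefA, coefA, prod_range_succ, mul_add, mul_one]
    ring

lemma coefA_mul_coefA (i : ℕ) (u v : ℕ → ℂ) :
    coefA i u v * coefA i v u = ∏ h ∈ range (2 * i), (u h * v h) := by
  induction i with
  | zero => simp [coefA]
  | succ i ih =>
    rw [show 2 * (i + 1) = 2 * i + 1 + 1 by ring, prod_range_succ, prod_range_succ, ← ih]
    simp only [coefA, prod_range_succ]
    ring

lemma coefA_ne_zero (i : ℕ) {u v : ℕ → ℂ} (hu : ∀ h, u h ≠ 0) (hv : ∀ h, v h ≠ 0) :
    coefA i u v ≠ 0 :=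
  prod_ne_zero_iff.2 fun _ _ => mul_ne_zero (hv _) (hu _)

/-- Here the chains omit exactly one index: the top one, the next one, or a lower one. Keeping the
factor `X` avoids the index `i - 1` and lets the recursion start at `i = 0`. -/
lemma coeff_X_mul_oddPoly_succ (i : ℕ) (u v : ℕ → ℂ) :
    (X * oddPoly (2 * (i + 1)) v u).coeff (i + 1)
      = (v (2 * i) + v (2 * i + 1)) * coefA i u v
        + u (2 * i) * v (2 * i + 1) * (X * oddPoly (2 * i) v u).coeff i := by
  have h1 : cascade (2 * i) (2 * i + 1) u v
      = coefA i u v + u (2 * i) * (X * oddPoly (2 * i) v u).coeff i := by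
    rw [← (cascade_diag i u v).1, ← coeff_evenPoly, ← coeff_evenPoly, evenPoly_succ, mul_assoc,
      coeff_add, coeff_C_mul]
  rw [coeff_X_mul, coeff_oddPoly, show 2 * (i + 1) = 2 * i + 1 + 1 by ring, cascade_succ_succ,
    (cascade_diag i v u).2, h1]
  ring

lemma inv_mul_prod (i : ℕ) (u v : ℕ → ℂ) : (1 / u 0) *
    ∏ h ∈ range i, (v (2 * h) * u (2 * h + 1)) / (v (2 * h + 1) * u (2 * h + 2))
      = coefA i u v / (u (2 * i) * coefA i v u) := by
  rw [prod_div_distrib, ← coefB_eq, coefB, ← coefA]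
  ring

/-- This identifies the explicit sum `P_i` with a quotient of coefficients of `M_{2i-1} ⋯ M_0`. It
serves twice: for the formula `a_k = A_k - P_k b_k` and for `R_i^{(i)} = P_i`. -/
lemma coefP_mul_coefA (i : ℕ) {u v : ℕ → ℂ} (hu : ∀ h, u h ≠ 0) (hv : ∀ h, v h ≠ 0) :
    coefP i u v * coefA i v u = -(X * oddPoly (2 * i) v u).coeff i := by
  induction i with
  | zero => simp [coefP]
  | succ i ih =>
    rw [coeff_X_mul_oddPoly_succ]
    have h1 : coefP (i + 1) u v = coefP i u v - (v (2 * i) / v (2 * i + 1) + 1) * (1 / u 0) *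
        ∏ h ∈ range i, (v (2 * h) * u (2 * h + 1)) / (v (2 * h + 1) * u (2 * h + 2)) := by
      rw [coefP, coefP, sum_range_succ]; ring
    have h2 : coefA (i + 1) v u = coefA i v u * (u (2 * i) * v (2 * i + 1)) := by
      rw [coefA, coefA, prod_range_succ]
    have h4 := coefA_ne_zero i hv hu
    rw [h1, h2, sub_mul, ← mul_assoc, ih, mul_assoc _ (1 / u 0), inv_mul_prod]
    have := hu (2 * i)
    have := hv (2 * i + 1)
    field_simp
    ring

/-! ### Compatibility as a polynomial identity -/

/-- `L̂ M = M̄ L` for the polynomial entries of `L = [[a, ν b], [ν c, d]]` and of its `m`-shift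
`L̂ = [[a', ν b'], [ν c', d']]`, in the variable `X = ν ^ 2`; the off-diagonal entries of `M` and
`M̄` are given by `β, γ` and `B, Γ`. -/
structure PolyCompat (β γ B Γ : ℂ) (a b c d a' b' c' d' : ℂ[X]) : Prop where
  e11 : a' + X * C γ * b' = a + X * C B * c
  e12 : C β * a' + b' = b + C B * d
  e21 : C γ * d' + c' = c + C Γ * a
  e22 : d' + X * C β * c' = d + X * C Γ * b

/-- `∑ f_i X ^ i` at the lattice point `(l, m)`. -/
def coeffPoly {k : ℕ} (f : Fin (k + 1) → Field2) (l m : ℤ) : ℂ[X] :=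
  ∑ i, C (f i l m) * X ^ (i : ℕ)

lemma coeff_coeffPoly {k : ℕ} (f : Fin (k + 1) → Field2) (l m : ℤ) (i : Fin (k + 1)) :
    (coeffPoly f l m).coeff i = f i l m := by
  simp [coeffPoly, coeff_X_pow, Fin.val_inj]

lemma natDegree_coeffPoly_le {k : ℕ} (f : Fin (k + 1) → Field2) (l m : ℤ) :
    (coeffPoly f l m).natDegree ≤ k :=
  natDegree_sum_le_of_forall_le _ _ fun i _ =>
    (natDegree_C_mul_X_pow_le _ _).trans (by omega)

lemma coeffPoly_eq {k : ℕ} {f : Fin (k + 1) → Field2} {l m : ℤ} {p : ℂ[X]} (hp : p.natDegree ≤ k)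
    (h : ∀ i : Fin (k + 1), f i l m = p.coeff i) : coeffPoly f l m = p := by
  ext i
  by_cases hi : i ≤ k
  · rw [← h ⟨i, by omega⟩]
    exact coeff_coeffPoly f l m ⟨i, by omega⟩
  · rw [coeff_eq_zero_of_natDegree_lt (hp.trans_lt (by omega)),
      coeff_eq_zero_of_natDegree_lt ((natDegree_coeffPoly_le f l m).trans_lt (by omega))]

lemma Lmat_eq {k : ℕ} (L : LaxCoeffs k) (l m : ℤ) (ν : ℂ) :
    Lmat L l m ν = !![(coeffPoly L.a l m).eval (ν ^ 2), ν * (coeffPoly L.b l m).eval (ν ^ 2);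
      ν * (coeffPoly L.c l m).eval (ν ^ 2), (coeffPoly L.d l m).eval (ν ^ 2)] := by
  simp only [Lmat, coeffPoly, eval_finsetSum, eval_mul, eval_C, eval_pow, eval_X, ← pow_mul,
    mul_sum]
  have h : ∀ f : Fin (k + 1) → Field2,
      ∑ i, f i l m * ν ^ (2 * (i : ℕ) + 1) = ∑ i, ν * (f i l m * ν ^ (2 * (i : ℕ))) :=
    fun f => sum_congr rfl fun i _ => by ring
  rw [h, h]

/-- Every complex number is a square, so nothing is lost in passing from `ν` to `ν²`. -/
lemma eq_of_eval_sq {p q : ℂ[X]} (h : ∀ ν : ℂ, p.eval (ν ^ 2) = q.eval (ν ^ 2)) : p = q := by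
  refine Polynomial.funext fun z => ?_
  obtain ⟨ν, rfl⟩ := IsAlgClosed.exists_pow_nat_eq z (n := 2) (by norm_num)
  exact h ν

lemma eq_of_mul_eval_sq {p q : ℂ[X]} (h : ∀ ν : ℂ, ν * p.eval (ν ^ 2) = ν * q.eval (ν ^ 2)) :
    p = q := by
  -- The hypothesis is void at `ν = 0`; one more factor `ν` turns it into an identity in `ν²` for
  -- the multiples by `X`.
  refine mul_left_cancel₀ X_ne_zero (eq_of_eval_sq fun ν => ?_)
  simp only [eval_mul, eval_X, sq, mul_assoc]
  rw [← sq, h]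

lemma compatible_iff {k : ℕ} (β γ : Field2) (L : LaxCoeffs k) :
    Compatible β γ L ↔ ∀ l m, PolyCompat (β l m) (γ l m) (β (l + 1) m) (γ (l + 1) m)
      (coeffPoly L.a l m) (coeffPoly L.b l m) (coeffPoly L.c l m) (coeffPoly L.d l m)
      (coeffPoly L.a l (m + 1)) (coeffPoly L.b l (m + 1))
      (coeffPoly L.c l (m + 1)) (coeffPoly L.d l (m + 1)) := by
  constructor
  · intro h l m
    have h00 := fun ν => congrFun₂ (h l m ν) 0 0
    have h01 := fun ν => congrFun₂ (h l m ν) 0 1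
    have h10 := fun ν => congrFun₂ (h l m ν) 1 0
    have h11 := fun ν => congrFun₂ (h l m ν) 1 1
    simp only [Lmat_eq, Mmat, mul_apply, Fin.sum_univ_two, of_apply, cons_val_zero, cons_val_one]
      at h00 h01 h10 h11
    simp at h00 h01 h10 h11
    refine ⟨eq_of_eval_sq fun ν => ?_, eq_of_mul_eval_sq fun ν => ?_,
      eq_of_mul_eval_sq fun ν => ?_, eq_of_eval_sq fun ν => ?_⟩ <;>
      simp only [eval_add, eval_mul, eval_X, eval_C]
    · linear_combination h00 ν
    · linear_combination h01 ν
    · linear_combination h10 ν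
    · linear_combination h11 ν
  · intro h l m ν
    obtain ⟨h1, h2, h3, h4⟩ := h l m
    have h00 := congrArg (eval (ν ^ 2)) h1
    have h01 := congrArg (eval (ν ^ 2)) h2
    have h10 := congrArg (eval (ν ^ 2)) h3
    have h11 := congrArg (eval (ν ^ 2)) h4
    simp only [eval_add, eval_mul, eval_X, eval_C] at h00 h01 h10 h11
    rw [Lmat_eq, Lmat_eq, Mmat, Mmat]
    ext i j
    fin_cases i <;> fin_cases j <;> simp [mul_apply, Fin.sum_univ_two]
    · linear_combination h00
    · linear_combination ν * h01
    · linear_combination ν * h10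
    · linear_combination h11

/-! ### Right division by `M` -/

/-- The hypothesis says that the row `(a, ν b)` annihilates the kernel vector `(β ν, -1)` of `M` at
`ν² = 1/(βγ)`. Hence `b - β a` is divisible by `det M = 1 - βγ X`, and the quotient is `b'`. -/
lemma exists_right_quotient_row {β γ : ℂ} (hβ : β ≠ 0) (hγ : γ ≠ 0) {a b : ℂ[X]}
    (h : β * a.eval (β * γ)⁻¹ = b.eval (β * γ)⁻¹) :
    ∃ a' b' : ℂ[X], a = a' + X * C γ * b' ∧ b = C β * a' + b' := by
  obtain ⟨q, hq⟩ : X - C (β * γ)⁻¹ ∣ b - C β * a := by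
    rw [dvd_iff_isRoot, IsRoot, eval_sub, eval_mul, eval_C, h, sub_self]
  have h1 : b - C β * a = (1 - X * C γ * C β) * (C (-(β * γ)⁻¹) * q) := by
    have h2 : (C (β * γ) * C (β * γ)⁻¹ : ℂ[X]) = 1 := by
      rw [← C_mul, mul_inv_cancel₀ (mul_ne_zero hβ hγ), C_1]
    rw [hq, C_neg]
    rw [C_mul] at h2
    linear_combination q * X * (-h2)
  exact ⟨a - X * C γ * (C (-(β * γ)⁻¹) * q), C (-(β * γ)⁻¹) * q, by ring,
    by linear_combination h1⟩

/-- With `n` the kernel vector of `M` at `ν² = 1/(βγ)`, the steps `e1` and `e2` are the two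
components of `M̄ L n = 0`, and `e3` uses that `det M̄` is nonzero there. -/
lemma PolyCompat.eval_eq {β γ B Γ : ℂ} {a b c d a' b' c' d' : ℂ[X]} (hβ : β ≠ 0) (hγ : γ ≠ 0)
    (hne : B * Γ ≠ β * γ) (h : PolyCompat β γ B Γ a b c d a' b' c' d') :
    β * a.eval (β * γ)⁻¹ = b.eval (β * γ)⁻¹ := by
  have h00 := congrArg (eval (β * γ)⁻¹) h.e11
  have h01 := congrArg (eval (β * γ)⁻¹) h.e12
  have h10 := congrArg (eval (β * γ)⁻¹) h.e21
  have h11 := congrArg (eval (β * γ)⁻¹) h.e22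
  simp only [eval_add, eval_mul, eval_X, eval_C] at h00 h01 h10 h11
  have hz : (β * γ)⁻¹ * (β * γ) = 1 := inv_mul_cancel₀ (mul_ne_zero hβ hγ)
  generalize (β * γ)⁻¹ = z at *
  have e1 : β * eval z a - eval z b = B * (eval z d - z * β * eval z c) := by
    linear_combination -β * h00 + h01 + eval z b' * hz
  have e2 : γ * (eval z d - z * β * eval z c) = z * γ * Γ * (β * eval z a - eval z b) := by
    linear_combination -γ * h11 + h10 + (eval z c' - eval z c - Γ * eval z a) * hz
  have e3 : (B * Γ - β * γ) * (β * eval z a - eval z b) = 0 := by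
    linear_combination -β * γ * e1 - β * B * e2 - B * Γ * (β * eval z a - eval z b) * hz
  have := (mul_eq_zero.1 e3).resolve_left (sub_ne_zero.2 hne)
  linear_combination this

lemma PolyCompat.swap {β γ B Γ : ℂ} {a b c d a' b' c' d' : ℂ[X]}
    (h : PolyCompat β γ B Γ a b c d a' b' c' d') : PolyCompat γ β Γ B d c b a d' c' b' a' :=
  ⟨h.e22, h.e21, h.e12, h.e11⟩

lemma one_sub_C_mul_X_ne_zero (w : ℂ) : (1 - C w * X : ℂ[X]) ≠ 0 := fun h => by
  simpa using congrArg (eval 0) h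

lemma row_cancel {β γ : ℂ} {p q p' q' : ℂ[X]} (h1 : p + X * C γ * q = p' + X * C γ * q')
    (h2 : C β * p + q = C β * p' + q') : p = p' ∧ q = q' := by
  have hp : p = p' := by
    refine mul_left_cancel₀ (one_sub_C_mul_X_ne_zero (β * γ)) ?_
    rw [C_mul]
    linear_combination h1 - X * C γ * h2
  subst hp
  exact ⟨rfl, by simpa using h2⟩

/-- If `L = L' M` and `L̂ = L̂' M̂`, then cancelling `M` on the right of `L̂' M̂ M = M̄ L' M` leaves
a relation of the same shape for `L'`, with `M̂` in place of `M` and the same `M̄`. -/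
lemma PolyCompat.quotient {β γ B Γ β' γ' : ℂ} {a b c d a' b' c' d' : ℂ[X]}
    (h : PolyCompat β γ B Γ (a + X * C γ * b) (C β * a + b) (C γ * d + c) (d + X * C β * c)
      (a' + X * C γ' * b') (C β' * a' + b') (C γ' * d' + c') (d' + X * C β' * c')) :
    PolyCompat β' γ' B Γ a b c d a' b' c' d' := by
  obtain ⟨h1, h2⟩ := row_cancel (p := a' + X * C γ' * b') (q := C β' * a' + b')
    (p' := a + X * C B * c) (q' := b + C B * d) (β := β) (γ := γ)
    (by linear_combination h.e11) (by linear_combination h.e12)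
  obtain ⟨h3, h4⟩ := row_cancel (p := d' + X * C β' * c') (q := C γ' * d' + c')
    (p' := d + X * C Γ * b) (q' := c + C Γ * a) (β := γ) (γ := β)
    (by linear_combination h.e22) (by linear_combination h.e21)
  exact ⟨h1, h2, h4, h3⟩

/-- A solution of the compatibility condition is divisible on the right by `M_{n-1} ⋯ M_0`. -/
theorem exists_right_quotient (n : ℕ) {β γ B Γ : ℤ → ℂ} (hβ : ∀ m, β m ≠ 0) (hγ : ∀ m, γ m ≠ 0)
    {a b c d : ℤ → ℂ[X]}
    (h : ∀ m, PolyCompat (β m) (γ m) (B m) (Γ m) (a m) (b m) (c m) (d m)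
      (a (m + 1)) (b (m + 1)) (c (m + 1)) (d (m + 1)))
    (hne : ∀ (m : ℤ) (h : ℕ), h < n → B m * Γ m ≠ β (m + h) * γ (m + h)) (m : ℤ) :
    ∃ e f g s : ℂ[X],
      a m = e * evenPoly n (fun h => β (m + h)) (fun h => γ (m + h))
        + X * f * oddPoly n (fun h => γ (m + h)) (fun h => β (m + h)) ∧
      b m = e * oddPoly n (fun h => β (m + h)) (fun h => γ (m + h))
        + f * evenPoly n (fun h => γ (m + h)) (fun h => β (m + h)) ∧
      d m = s * evenPoly n (fun h => γ (m + h)) (fun h => β (m + h))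
        + X * g * oddPoly n (fun h => β (m + h)) (fun h => γ (m + h)) ∧
      c m = s * oddPoly n (fun h => γ (m + h)) (fun h => β (m + h))
        + g * evenPoly n (fun h => β (m + h)) (fun h => γ (m + h)) := by
  induction n generalizing β γ a b c d m with
  | zero => exact ⟨a m, b m, c m, d m, by simp⟩
  | succ n ih =>
    have hne0 : ∀ m, B m * Γ m ≠ β m * γ m := fun m => by simpa using hne m 0 (by omega)
    have hq1 := fun m => exists_right_quotient_row (hβ m) (hγ m)
      ((h m).eval_eq (hβ m) (hγ m) (hne0 m))
    have hq2 := fun m => exists_right_quotient_row (hγ m) (hβ m)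
      ((h m).swap.eval_eq (hγ m) (hβ m) (by rw [mul_comm, mul_comm (γ m)]; exact hne0 m))
    choose a₁ b₁ ha hb using hq1
    choose d₁ c₁ hd hc using hq2
    -- The quotient by `M_0` is compatible with `β, γ` shifted once and `B, Γ` unchanged, so the
    -- remaining nonresonance conditions are those for `h + 1`.
    obtain ⟨e, f, g, s, h1, h2, h3, h4⟩ := ih (β := fun m => β (m + 1)) (γ := fun m => γ (m + 1))
      (a := a₁) (b := b₁) (c := c₁) (d := d₁) (fun m => hβ _) (fun m => hγ _)
      (fun m => PolyCompat.quotient (β := β m) (γ := γ m) (by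
        rw [← ha, ← hb, ← hc, ← hd, ← ha, ← hb, ← hc, ← hd]; exact h m))
      (fun m j hj => by
        have := hne m (j + 1) (by omega)
        rwa [show m + ((j + 1 : ℕ) : ℤ) = m + j + 1 by push_cast; ring] at this) m
    have hs : ∀ φ : ℤ → ℂ, (fun j : ℕ => φ (m + ((j + 1 : ℕ) : ℤ))) = fun j : ℕ => φ (m + j + 1) :=
      fun φ => by ext j; push_cast; ring_nf
    obtain ⟨E1, O1⟩ := evenPoly_succ' n (fun h : ℕ => β (m + h)) (fun h => γ (m + h))
    obtain ⟨E2, O2⟩ := evenPoly_succ' n (fun h : ℕ => γ (m + h)) (fun h => β (m + h))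
    simp only [hs, Nat.cast_zero, add_zero] at E1 O1 E2 O2
    refine ⟨e, f, g, s, ?_, ?_, ?_, ?_⟩
    · rw [ha, E1, O2, h1, h2]; ring
    · rw [hb, O1, E2, h1, h2]; ring
    · rw [hd, E2, O1, h3, h4]; ring
    · rw [hc, O2, E1, h3, h4]; ring

/-! ### The canonical `L` -/

/-- The diagonal entry in the first row of `K M_{2k-1} ⋯ M_0`, where `K` has first row `(1, p ν)`. -/
def canonA (k : ℕ) (u v : ℕ → ℂ) (p : ℂ) : ℂ[X] :=
  evenPoly (2 * k) u v + C p * (X * oddPoly (2 * k) v u)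

/-- The off-diagonal entry of the same row, divided by `ν`. -/
def canonB (k : ℕ) (u v : ℕ → ℂ) (p : ℂ) : ℂ[X] :=
  oddPoly (2 * k) u v + C p * evenPoly (2 * k) v u

lemma natDegree_X_mul_oddPoly_le (k : ℕ) (u v : ℕ → ℂ) :
    (X * oddPoly (2 * k) u v).natDegree ≤ k := by
  rw [natDegree_le_iff_coeff_eq_zero]
  intro j hj
  obtain ⟨j, rfl⟩ := Nat.exists_eq_succ_of_ne_zero (by omega : j ≠ 0)
  rw [coeff_X_mul, coeff_oddPoly_eq_zero (by omega)]

lemma natDegree_canonA_le (k : ℕ) (u v : ℕ → ℂ) (p : ℂ) : (canonA k u v p).natDegree ≤ k :=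
  natDegree_add_le_of_degree_le (natDegree_evenPoly_le (by omega) _ _)
    ((natDegree_C_mul_le _ _).trans (natDegree_X_mul_oddPoly_le _ _ _))

lemma natDegree_canonB_le (k : ℕ) (u v : ℕ → ℂ) (p : ℂ) : (canonB k u v p).natDegree ≤ k :=
  natDegree_add_le_of_degree_le (natDegree_oddPoly_le (by omega) _ _)
    ((natDegree_C_mul_le _ _).trans (natDegree_evenPoly_le (by omega) _ _))

lemma canonA_coeff_zero (k : ℕ) (u v : ℕ → ℂ) (p : ℂ) : (canonA k u v p).coeff 0 = 1 := by
  simp [canonA, evenPoly_coeff_zero]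

lemma canonB_coeff_top (k : ℕ) (u v : ℕ → ℂ) (p : ℂ) :
    (canonB k u v p).coeff k = p * coefA k v u := by
  rw [canonB, coeff_add, coeff_oddPoly_eq_zero (by omega), coeff_C_mul, coeff_evenPoly,
    (cascade_diag k v u).1, zero_add]

lemma canonA_coeff_top (k : ℕ) {u v : ℕ → ℂ} (hu : ∀ h, u h ≠ 0) (hv : ∀ h, v h ≠ 0) (p : ℂ) :
    (canonA k u v p).coeff k = coefA k u v - coefP k u v * (canonB k u v p).coeff k := by
  rw [canonB_coeff_top, mul_left_comm, coefP_mul_coefA k hu hv, canonA, coeff_add, coeff_C_mul,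
    coeff_evenPoly, (cascade_diag k u v).1]
  ring

lemma natDegree_det {n : ℕ} {u v : ℕ → ℂ} (hu : ∀ h, u h ≠ 0) (hv : ∀ h, v h ≠ 0) :
    (∏ h ∈ range n, (1 - C (u h * v h) * X : ℂ[X])).natDegree = n := by
  rw [natDegree_prod _ _ fun h _ => one_sub_C_mul_X_ne_zero _, sum_congr rfl (g := fun _ => 1)]
  · simp
  · intro h _
    rw [show (1 - C (u h * v h) * X : ℂ[X]) = C (-(u h * v h)) * X + C 1 by simp; ring]
    exact natDegree_linear (neg_ne_zero.2 (mul_ne_zero (hu h) (hv h)))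

lemma eq_C_of_mul_det {n : ℕ} {u v : ℕ → ℂ} (hu : ∀ h, u h ≠ 0) (hv : ∀ h, v h ≠ 0) {e q : ℂ[X]}
    (h : e * ∏ h ∈ range n, (1 - C (u h * v h) * X) = q) (hq : q.natDegree ≤ n) :
    e = C (e.coeff 0) := by
  by_cases he : e = 0
  · simp [he]
  refine eq_C_of_natDegree_eq_zero ?_
  rw [← h, natDegree_mul he (prod_ne_zero_iff.2 fun h _ => one_sub_C_mul_X_ne_zero _),
    natDegree_det hu hv] at hq
  omega

/-- Multiplying the row by the adjugate of `M_{2k-1} ⋯ M_0` isolates `e` and `f` times a determinant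
of degree exactly `2k`. The products on the other side have degree at most `2k`, so `e` and `f` are
constants; the lowest coefficient of `a` gives `e = 1`, the top one of `b` gives `f = p`. -/
lemma eq_canon {k : ℕ} {u v : ℕ → ℂ} (hu : ∀ h, u h ≠ 0) (hv : ∀ h, v h ≠ 0) {p : ℂ}
    {a b e f : ℂ[X]} (ha : a = e * evenPoly (2 * k) u v + X * f * oddPoly (2 * k) v u)
    (hb : b = e * oddPoly (2 * k) u v + f * evenPoly (2 * k) v u)
    (hda : a.natDegree ≤ k) (hdb : b.natDegree ≤ k) (ha0 : a.coeff 0 = 1)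
    (hbk : b.coeff k = p * coefA k v u) : a = canonA k u v p ∧ b = canonB k u v p := by
  have hE := fun u v => natDegree_evenPoly_le (N := 2 * k) (i := k) (by omega) u v
  have hXO := natDegree_X_mul_oddPoly_le k
  have hO := fun u v => natDegree_oddPoly_le (N := 2 * k) (i := k) (by omega) u v
  have he := eq_C_of_mul_det hu hv (n := 2 * k) (e := e)
    (q := a * evenPoly (2 * k) v u - b * (X * oddPoly (2 * k) v u))
    (by rw [← det_rowPoly, ha, hb]; ring)
    ((natDegree_sub_le _ _).trans (max_le
      (natDegree_mul_le.trans (by have := hE v u; omega))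
      (natDegree_mul_le.trans (by have := hXO v u; omega))))
  have hf := eq_C_of_mul_det hu hv (n := 2 * k) (e := f)
    (q := b * evenPoly (2 * k) u v - a * oddPoly (2 * k) u v)
    (by rw [← det_rowPoly, ha, hb]; ring)
    ((natDegree_sub_le _ _).trans (max_le
      (natDegree_mul_le.trans (by have := hE u v; omega))
      (natDegree_mul_le.trans (by have := hO u v; omega))))
  rw [he] at ha hb
  rw [hf] at ha hb
  have he1 : e.coeff 0 = 1 := by
    rw [← ha0, ha, mul_assoc]
    simp [evenPoly_coeff_zero]
  rw [he1, C_1, one_mul] at ha hb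
  have hfp : f.coeff 0 = p := by
    rw [hb, coeff_add, coeff_oddPoly_eq_zero (by omega), coeff_C_mul, coeff_evenPoly,
      (cascade_diag k v u).1, zero_add] at hbk
    exact mul_right_cancel₀ (coefA_ne_zero k hv hu) hbk
  rw [hfp] at ha hb
  exact ⟨by rw [ha, canonA]; ring, by rw [hb, canonB]⟩

/-- Compatibility of the canonical `L` reduces to the compatibility of `K` and `M_{2k}`. -/
lemma polyCompat_canon_iff (k : ℕ) (u v : ℕ → ℂ) (p q p' q' B Γ : ℂ)
    (h1 : p' * v (2 * k) = B * q) (h2 : q' * u (2 * k) = Γ * p) :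
    PolyCompat (u 0) (v 0) B Γ (canonA k u v p) (canonB k u v p) (canonB k v u q) (canonA k v u q)
      (canonA k (fun h => u (h + 1)) (fun h => v (h + 1)) p')
      (canonB k (fun h => u (h + 1)) (fun h => v (h + 1)) p')
      (canonB k (fun h => v (h + 1)) (fun h => u (h + 1)) q')
      (canonA k (fun h => v (h + 1)) (fun h => u (h + 1)) q') ↔
    u (2 * k) + p' = p + B ∧ v (2 * k) + q' = q + Γ := by
  -- Two expansions of `M_{2k} ⋯ M_0` are equated: splitting off `M_{2k}` on the left and `M_0` on
  -- the right.
  obtain ⟨E1, O1⟩ := evenPoly_succ' (2 * k) u v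
  obtain ⟨E2, O2⟩ := evenPoly_succ' (2 * k) v u
  rw [evenPoly_succ] at E1 E2
  rw [oddPoly_succ] at O1 O2
  have h1' := congrArg (C : ℂ → ℂ[X]) h1
  have h2' := congrArg (C : ℂ → ℂ[X]) h2
  rw [C_mul, C_mul] at h1' h2'
  simp only [canonA, canonB]
  constructor
  · intro h
    constructor
    · have : evenPoly (2 * k) v u * C (u (2 * k) + p' - p - B) = 0 := by
        simp only [C_add, C_sub]
        linear_combination h.e12 + O1 + C p' * E2 - X * oddPoly (2 * k) u v * h1'
      have := C_eq_zero.1 ((mul_eq_zero.1 this).resolve_left (evenPoly_ne_zero _ _ _))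
      linear_combination this
    · have : evenPoly (2 * k) u v * C (v (2 * k) + q' - q - Γ) = 0 := by
        simp only [C_add, C_sub]
        linear_combination h.e21 + O2 + C q' * E1 - X * oddPoly (2 * k) v u * h2'
      have := C_eq_zero.1 ((mul_eq_zero.1 this).resolve_left (evenPoly_ne_zero _ _ _))
      linear_combination this
  · rintro ⟨h3, h4⟩
    have h3' := congrArg (C : ℂ → ℂ[X]) h3
    have h4' := congrArg (C : ℂ → ℂ[X]) h4
    rw [C_add, C_add] at h3' h4'
    constructor
    · linear_combination -E1 - C p' * X * O2 + X * oddPoly (2 * k) v u * h3'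
        + X * evenPoly (2 * k) u v * h1'
    · linear_combination -O1 - C p' * E2 + evenPoly (2 * k) v u * h3'
        + X * oddPoly (2 * k) u v * h1'
    · linear_combination -O2 - C q' * E1 + evenPoly (2 * k) u v * h4'
        + X * oddPoly (2 * k) v u * h2'
    · linear_combination -E2 - C q' * X * O1 + X * oddPoly (2 * k) u v * h4'
        + X * evenPoly (2 * k) v u * h2'

/-! ### Lagrange sums -/

/-- `∑ F(w_h) w_h ^ e / ∏ (w_h - w_g)` over the nodes `w_h`, `h < n`. -/
def lagrangeSum (n : ℕ) (w : ℕ → ℂ) (F : ℂ[X]) (e : ℤ) : ℂ :=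
  ∑ h ∈ range n, F.eval (w h) * w h ^ e / ∏ g ∈ (range n).erase h, (w h - w g)

lemma lagrangeSum_zero {n : ℕ} {w : ℕ → ℂ} (hw : Set.InjOn w (range n)) {F : ℂ[X]}
    (hF : F.degree < n) : lagrangeSum n w F 0 = F.coeff (n - 1) := by
  have := Lagrange.coeff_eq_sum hw (P := F) (by simpa using hF)
  rw [card_range] at this
  simp [this, lagrangeSum]

lemma lagrangeSum_natCast {n : ℕ} {w : ℕ → ℂ} (hw : Set.InjOn w (range n)) {F : ℂ[X]} {e : ℕ}
    (hF : F.natDegree + e < n) : lagrangeSum n w F e = (F * X ^ e).coeff (n - 1) := by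
  rw [← lagrangeSum_zero hw]
  · simp [lagrangeSum]
  · refine degree_le_natDegree.trans_lt (Nat.cast_lt.2 (lt_of_le_of_lt natDegree_mul_le ?_))
    rwa [natDegree_X_pow]

lemma lagrangeSum_natCast_eq_zero {n : ℕ} {w : ℕ → ℂ} (hw : Set.InjOn w (range n)) {F : ℂ[X]}
    {e : ℕ} (hF : F.natDegree + e + 1 < n) : lagrangeSum n w F e = 0 := by
  rw [lagrangeSum_natCast hw (by omega), coeff_eq_zero_of_natDegree_lt]
  refine lt_of_le_of_lt natDegree_mul_le ?_
  rw [natDegree_X_pow]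
  omega

/-- Let `N` be the nodal polynomial. At a node, `N = 0` gives `N.divX = -N(0) / w`, while the
Lagrange sum of the monic `N.divX` is its leading coefficient `1`. -/
lemma lagrangeSum_one_neg_one {n : ℕ} {w : ℕ → ℂ} (hw : Set.InjOn w (range (n + 1)))
    (h0 : ∀ h, w h ≠ 0) :
    lagrangeSum (n + 1) w 1 (-1) * ∏ h ∈ range (n + 1), w h = (-1) ^ n := by
  set N := Lagrange.nodal (range (n + 1)) w with hN
  have hN0 : N.coeff 0 = (-1) ^ (n + 1) * ∏ h ∈ range (n + 1), w h := by
    rw [coeff_zero_eq_eval_zero, hN, Lagrange.eval_nodal]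
    simp [prod_neg]
  have hdeg : N.natDegree = n + 1 := by simp [hN]
  have h1 : N.divX.coeff n = 1 := by
    have h2 : N.Monic := Lagrange.nodal_monic
    rw [coeff_divX, ← hdeg]
    exact h2
  have h2 : lagrangeSum (n + 1) w N.divX 0 = 1 := by
    rw [lagrangeSum_zero hw, Nat.add_sub_cancel, h1]
    refine degree_le_natDegree.trans_lt (Nat.cast_lt.2 ?_)
    rw [natDegree_divX_eq_natDegree_tsub_one, hdeg]
    omega
  have h3 : lagrangeSum (n + 1) w N.divX 0 = -N.coeff 0 * lagrangeSum (n + 1) w 1 (-1) := by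
    rw [lagrangeSum, lagrangeSum, mul_sum]
    refine sum_congr rfl fun h hh => ?_
    have h4 : N.divX.eval (w h) * w h + N.coeff 0 = 0 := by
      have := congrArg (eval (w h)) (divX_mul_X_add N)
      rw [eval_add, eval_mul, eval_X, eval_C, hN, Lagrange.eval_nodal_at_node hh] at this
      exact this
    have h5 : N.divX.eval (w h) = -N.coeff 0 * (w h)⁻¹ := by
      rw [eq_mul_inv_iff_mul_eq₀ (h0 h)]
      linear_combination h4
    rw [h5]
    simp
    ring
  have h6 : ((-1) ^ n * (-1) ^ n : ℂ) = 1 := by rw [← mul_pow]; simp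
  rw [h3, hN0] at h2
  linear_combination (-1) ^ n * h2 - lagrangeSum (n + 1) w 1 (-1)
    * (∏ h ∈ range (n + 1), w h) * h6

/-- In `F / X = F.divX + F(0) / X` the polynomial part has degree too small to contribute. -/
lemma lagrangeSum_neg_one {n : ℕ} {w : ℕ → ℂ} (hw : Set.InjOn w (range (n + 1)))
    (h0 : ∀ h, w h ≠ 0) {F : ℂ[X]} (hF : F.natDegree ≤ n) :
    lagrangeSum (n + 1) w F (-1) * ∏ h ∈ range (n + 1), w h = F.coeff 0 * (-1) ^ n := by
  have h1 : lagrangeSum (n + 1) w F (-1)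
      = lagrangeSum (n + 1) w F.divX 0 + F.coeff 0 * lagrangeSum (n + 1) w 1 (-1) := by
    rw [lagrangeSum, lagrangeSum, lagrangeSum, mul_sum, ← sum_add_distrib]
    refine sum_congr rfl fun h _ => ?_
    conv_lhs => rw [← divX_mul_X_add F]
    have := h0 h
    simp
    field_simp
  rw [h1, lagrangeSum_zero hw, coeff_divX, coeff_eq_zero_of_natDegree_lt (by omega), zero_add,
    mul_assoc, lagrangeSum_one_neg_one hw h0]
  refine degree_le_natDegree.trans_lt (Nat.cast_lt.2 ?_)
  rw [natDegree_divX_eq_natDegree_tsub_one]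
  omega

/-- Lowering the exponent by `j` against the `j`-th coefficient assembles `p(1 / w_h)`. Thus linear
relations on coefficients become relations on values at the zeros of the determinant. -/
lemma sum_lagrangeSum_mul_coeff (n : ℕ) {w : ℕ → ℂ} (h0 : ∀ h, w h ≠ 0) (F : ℂ[X]) (e : ℤ)
    {p : ℂ[X]} {k : ℕ} (hp : p.natDegree ≤ k) :
    ∑ j ∈ range (k + 1), lagrangeSum n w F (e - j) * p.coeff j
      = ∑ h ∈ range n, F.eval (w h) * w h ^ e * p.eval (w h)⁻¹
          / ∏ g ∈ (range n).erase h, (w h - w g) := by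
  simp only [lagrangeSum, sum_mul]
  rw [sum_comm]
  refine sum_congr rfl fun h _ => ?_
  rw [eval_eq_sum_range' (Nat.lt_succ_of_le hp), mul_sum, sum_div]
  refine sum_congr rfl fun j _ => ?_
  rw [zpow_sub₀ (h0 h), zpow_natCast, inv_pow]
  ring

/-! ### Coefficients of the linear system as Lagrange sums -/

/-- `X ^ i * p(1 / X)`. -/
def reversePoly (i : ℕ) (p : ℂ[X]) : ℂ[X] := ∑ g ∈ range (i + 1), C (p.coeff (i - g)) * X ^ g

lemma coeff_reversePoly (i g : ℕ) (p : ℂ[X]) :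
    (reversePoly i p).coeff g = if g ≤ i then p.coeff (i - g) else 0 := by
  simp [reversePoly, coeff_X_pow]

lemma natDegree_reversePoly_le (i : ℕ) (p : ℂ[X]) : (reversePoly i p).natDegree ≤ i := by
  rw [natDegree_le_iff_coeff_eq_zero]
  intro g hg
  rw [coeff_reversePoly, if_neg (by omega)]

lemma eval_reversePoly {i : ℕ} {p : ℂ[X]} (hp : p.natDegree ≤ i) {z : ℂ} (hz : z ≠ 0) :
    (reversePoly i p).eval z = z ^ i * p.eval z⁻¹ := by
  rw [reversePoly, eval_finsetSum, ← sum_range_reflect, eval_eq_sum_range' (Nat.lt_succ_of_le hp),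
    mul_sum]
  refine sum_congr rfl fun g hg => ?_
  have hg : g ≤ i := Nat.lt_succ_iff.1 (mem_range.1 hg)
  rw [show i + 1 - 1 - g = i - g by omega, Nat.sub_sub_self hg, eval_mul, eval_C, eval_pow, eval_X,
    pow_sub₀ _ hz hg, inv_pow]
  ring

lemma eval_reversePoly_eq_sum (i : ℕ) (p : ℂ[X]) (z : ℂ) :
    (reversePoly i p).eval z = ∑ g ∈ range (i + 1), p.coeff (i - g) * z ^ g := by
  simp [reversePoly, eval_finsetSum]

/-- There are `2 * i` factors, so the signs cancel; this reconciles the denominator of `U` with that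
of the Lagrange sum. -/
lemma prod_sub_comm_of_odd {i h : ℕ} (w : ℕ → ℂ) (hh : h ∈ range (2 * i + 1)) :
    ∏ g ∈ (range (2 * i + 1)).erase h, (w g - w h)
      = ∏ g ∈ (range (2 * i + 1)).erase h, (w h - w g) := by
  rw [← prod_congr rfl (fun g _ => neg_sub (w h) (w g)), prod_neg, card_erase_of_mem hh,
    card_range]
  simp

lemma sum_eta_even (i : ℕ) (u v : ℕ → ℂ) (z : ℂ) :
    ∑ g ∈ range (i + 1), eta (2 * i) (2 * g) v u * z ^ g
      = (reversePoly i (oddPoly (2 * i + 1) v u)).eval z := by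
  rw [eval_reversePoly_eq_sum]
  refine sum_congr rfl fun g hg => ?_
  rw [eta, show 2 * i + 1 - 2 * g = 2 * (i - g) + 1 by have := mem_range.1 hg; omega,
    ← coeff_oddPoly]

lemma sum_xi_even (i : ℕ) (u v : ℕ → ℂ) (z : ℂ) :
    ∑ g ∈ range (i + 1), xi (2 * i) (2 * g) v u * z ^ g
      = (reversePoly i (evenPoly (2 * i + 1) v u)).eval z := by
  rw [eval_reversePoly_eq_sum]
  refine sum_congr rfl fun g hg => ?_
  have := mem_range.1 hg
  rw [xi, if_pos (by omega), show 2 * i - 2 * g = 2 * (i - g) by omega, ← coeff_evenPoly]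

lemma sum_eta_odd {i : ℕ} (hi : 1 ≤ i) (u v : ℕ → ℂ) (z : ℂ) :
    ∑ g ∈ range (i + 1), eta (2 * i - 1) (2 * g) v u * z ^ g
      = (reversePoly i (evenPoly (2 * i) v u)).eval z := by
  rw [eval_reversePoly_eq_sum]
  refine sum_congr rfl fun g hg => ?_
  rw [eta, show 2 * i - 1 + 1 = 2 * i by omega,
    show 2 * i - 2 * g = 2 * (i - g) by omega, ← coeff_evenPoly]

lemma sum_xi_odd {i : ℕ} (hi : 1 ≤ i) (u v : ℕ → ℂ) (z : ℂ) :
    ∑ g ∈ range (i + 1), xi (2 * i - 1) (2 * g) v u * z ^ g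
      = (reversePoly i (X * oddPoly (2 * i) v u)).eval z := by
  rw [eval_reversePoly_eq_sum]
  refine sum_congr rfl fun g hg => ?_
  have := mem_range.1 hg
  rcases Nat.lt_or_ge g i with hgi | hgi
  · obtain ⟨r, hr⟩ : ∃ r, i - g = r + 1 := ⟨i - g - 1, by omega⟩
    rw [xi, if_pos (by omega), hr, coeff_X_mul, coeff_oddPoly,
      show 2 * i - 1 - 2 * g = 2 * r + 1 by omega, show 2 * i - 1 + 1 = 2 * i by omega]
  -- For `g = i` the convention that `ξ` vanishes when `a < b` matches the zero constant coefficient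
  -- of `X * oddPoly`.
  · rw [xi, if_neg (by omega), show i - g = 0 by omega, coeff_X_mul_zero]

section
variable {u v : ℕ → ℂ} (hu : ∀ h, u h ≠ 0) (hv : ∀ h, v h ≠ 0)
include hu hv

lemma coefT_eq (i j : ℕ) : coefT i j u v = coefB i u v * lagrangeSum (2 * i + 1)
    (fun h => u h * v h) (reversePoly i (oddPoly (2 * i + 1) v u)) ((i : ℤ) - 1 - j) := by
  rw [coefT, lagrangeSum, mul_sum]
  refine sum_congr rfl fun h hh => ?_
  rw [coefU, prod_sub_comm_of_odd (fun h => u h * v h) hh, sum_eta_even,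
    zpow_sub₀ (mul_ne_zero (hu h) (hv h)) _ (j : ℤ), zpow_natCast]
  ring

lemma coefS_eq (i j : ℕ) : coefS i j u v = -coefB i u v * lagrangeSum (2 * i + 1)
    (fun h => u h * v h) (reversePoly i (evenPoly (2 * i + 1) v u)) ((i : ℤ) - j) := by
  rw [coefS, lagrangeSum, mul_sum]
  refine sum_congr rfl fun h hh => ?_
  have hw := mul_ne_zero (hu h) (hv h)
  have h1 : (u h * v h) ^ (i : ℤ) = (u h * v h) ^ ((i : ℤ) - 1) * (u h * v h) := by
    rw [← zpow_add_one₀ hw, sub_add_cancel]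
  rw [coefU, prod_sub_comm_of_odd (fun h => u h * v h) hh, sum_xi_even,
    zpow_sub₀ hw _ (j : ℤ), h1, zpow_natCast]
  ring

lemma coefQ_eq {i : ℕ} (hi : 1 ≤ i) (j : ℕ) : coefQ i j u v = -coefA i u v *
    lagrangeSum (2 * i) (fun h => u h * v h) (reversePoly i (evenPoly (2 * i) v u))
      ((i : ℤ) - 1 - j) := by
  rw [coefQ, lagrangeSum, mul_sum]
  refine sum_congr rfl fun h hh => ?_
  rw [coefV, sum_eta_odd hi, zpow_sub₀ (mul_ne_zero (hu h) (hv h)) _ (j : ℤ), zpow_natCast]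
  ring

lemma coefR_eq {i : ℕ} (hi : 1 ≤ i) (j : ℕ) : coefR i j u v = coefA i u v *
    lagrangeSum (2 * i) (fun h => u h * v h) (reversePoly i (X * oddPoly (2 * i) v u))
      ((i : ℤ) - 1 - j) := by
  rw [coefR, lagrangeSum, mul_sum]
  refine sum_congr rfl fun h hh => ?_
  rw [coefV, sum_xi_odd hi, zpow_sub₀ (mul_ne_zero (hu h) (hv h)) _ (j : ℤ), zpow_natCast]
  ring

/-! ### The values that vanish or are trivial -/

lemma prod_ne_zero_of_ne (n : ℕ) : ∏ h ∈ range n, (u h * v h) ≠ 0 :=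
  prod_ne_zero_iff.2 fun _ _ => mul_ne_zero (hu _) (hv _)

lemma coefT_of_lt {i j : ℕ} (hw : Set.InjOn (fun h => u h * v h) (range (2 * i + 1)))
    (hj : j < i) : coefT i j u v = 0 := by
  rw [coefT_eq hu hv, show (i : ℤ) - 1 - j = ((i - 1 - j : ℕ) : ℤ) by omega,
    lagrangeSum_natCast_eq_zero hw, mul_zero]
  have := natDegree_reversePoly_le i (oddPoly (2 * i + 1) v u)
  omega

lemma coefT_self {i : ℕ} (hw : Set.InjOn (fun h => u h * v h) (range (2 * i + 1))) :
    coefT i i u v = 1 := by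
  have h1 := lagrangeSum_neg_one hw (fun h => mul_ne_zero (hu h) (hv h))
    (F := reversePoly i (oddPoly (2 * i + 1) v u))
    ((natDegree_reversePoly_le _ _).trans (by omega))
  rw [coeff_reversePoly, if_pos (by omega), Nat.sub_zero, coeff_oddPoly, (cascade_diag i v u).2,
    pow_mul, neg_one_sq, one_pow, mul_one] at h1
  refine mul_right_cancel₀ (prod_ne_zero_of_ne hu hv (2 * i + 1)) ?_
  rw [coefT_eq hu hv, show (i : ℤ) - 1 - i = -1 by ring, mul_assoc, h1, coefB_eq, one_mul,
    prod_range_succ, ← coefA_mul_coefA]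
  ring

/-- The exponent `i` is the one for which `F X^i` just reaches degree `n - 1 = 2 * i`. The resulting
entry, paired with `a_0 = 1`, becomes the right-hand side `B_i`. -/
lemma coefS_zero {i : ℕ} (hw : Set.InjOn (fun h => u h * v h) (range (2 * i + 1))) :
    coefS i 0 u v = -coefB i u v := by
  rw [coefS_eq hu hv, show (i : ℤ) - (0 : ℕ) = (i : ℕ) by simp, lagrangeSum_natCast hw,
    show 2 * i + 1 - 1 = i + i by omega, coeff_mul_X_pow, coeff_reversePoly, if_pos le_rfl,
    Nat.sub_self, evenPoly_coeff_zero, mul_one]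
  have := natDegree_reversePoly_le i (evenPoly (2 * i + 1) v u)
  omega

lemma coefS_of_le {i j : ℕ} (hw : Set.InjOn (fun h => u h * v h) (range (2 * i + 1)))
    (hj : 1 ≤ j) (hji : j ≤ i) : coefS i j u v = 0 := by
  rw [coefS_eq hu hv, show (i : ℤ) - j = ((i - j : ℕ) : ℤ) by omega,
    lagrangeSum_natCast_eq_zero hw, mul_zero]
  have := natDegree_reversePoly_le i (evenPoly (2 * i + 1) v u)
  omega

lemma coefQ_zero {i : ℕ} (hi : 1 ≤ i) (hw : Set.InjOn (fun h => u h * v h) (range (2 * i))) :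
    coefQ i 0 u v = -coefA i u v := by
  have := natDegree_reversePoly_le i (evenPoly (2 * i) v u)
  rw [coefQ_eq hu hv hi, show (i : ℤ) - 1 - (0 : ℕ) = ((i - 1 : ℕ) : ℤ) by omega,
    lagrangeSum_natCast hw (by omega),
    show 2 * i - 1 = i + (i - 1) by omega, coeff_mul_X_pow, coeff_reversePoly, if_pos le_rfl,
    Nat.sub_self, evenPoly_coeff_zero, mul_one]

lemma coefQ_of_lt {i j : ℕ} (hw : Set.InjOn (fun h => u h * v h) (range (2 * i)))
    (hj : 1 ≤ j) (hji : j < i) : coefQ i j u v = 0 := by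
  rw [coefQ_eq hu hv (by omega), show (i : ℤ) - 1 - j = ((i - 1 - j : ℕ) : ℤ) by omega,
    lagrangeSum_natCast_eq_zero hw, mul_zero]
  have := natDegree_reversePoly_le i (evenPoly (2 * i) v u)
  omega

lemma coefQ_self {i : ℕ} (hi : 1 ≤ i) (hw : Set.InjOn (fun h => u h * v h) (range (2 * i))) :
    coefQ i i u v = 1 := by
  obtain ⟨r, rfl⟩ := Nat.exists_eq_add_of_le' hi
  have h1 := lagrangeSum_neg_one (n := 2 * r + 1) hw (fun h => mul_ne_zero (hu h) (hv h))
    (F := reversePoly (r + 1) (evenPoly (2 * (r + 1)) v u))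
    ((natDegree_reversePoly_le _ _).trans (by omega))
  rw [coeff_reversePoly, if_pos (by omega), Nat.sub_zero, coeff_evenPoly, (cascade_diag _ v u).1,
    pow_succ, pow_mul, neg_one_sq, one_pow, one_mul] at h1
  refine mul_right_cancel₀ (prod_ne_zero_of_ne hu hv (2 * r + 1 + 1)) ?_
  rw [coefQ_eq hu hv hi, show ((r + 1 : ℕ) : ℤ) - 1 - (r + 1 : ℕ) = -1 by ring, mul_assoc]
  erw [h1]
  rw [show 2 * r + 1 + 1 = 2 * (r + 1) by ring, ← coefA_mul_coefA]
  ring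

lemma coefR_of_lt {i j : ℕ} (hw : Set.InjOn (fun h => u h * v h) (range (2 * i)))
    (hji : j < i) : coefR i j u v = 0 := by
  -- The general bound `i` would fail for `j = 0`; the factor `X` lowers the degree by one.
  have h1 : (reversePoly i (X * oddPoly (2 * i) v u)).natDegree ≤ i - 1 := by
    rw [natDegree_le_iff_coeff_eq_zero]
    intro g hg
    rw [coeff_reversePoly]
    split_ifs
    · rw [show i - g = 0 by omega, coeff_X_mul_zero]
    · rfl
  rw [coefR_eq hu hv (by omega), show (i : ℤ) - 1 - j = ((i - 1 - j : ℕ) : ℤ) by omega,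
    lagrangeSum_natCast_eq_zero hw (by omega), mul_zero]

lemma coefR_self {i : ℕ} (hi : 1 ≤ i) (hw : Set.InjOn (fun h => u h * v h) (range (2 * i))) :
    coefR i i u v = coefP i u v := by
  obtain ⟨r, rfl⟩ := Nat.exists_eq_add_of_le' hi
  have h1 := lagrangeSum_neg_one (n := 2 * r + 1) hw (fun h => mul_ne_zero (hu h) (hv h))
    (F := reversePoly (r + 1) (X * oddPoly (2 * (r + 1)) v u))
    ((natDegree_reversePoly_le _ _).trans (by omega))
  rw [coeff_reversePoly, if_pos (by omega), Nat.sub_zero, ← neg_eq_iff_eq_neg.2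
    (coefP_mul_coefA (r + 1) hu hv), pow_succ, pow_mul, neg_one_sq, one_pow, one_mul] at h1
  refine mul_right_cancel₀ (prod_ne_zero_of_ne hu hv (2 * r + 1 + 1)) ?_
  rw [coefR_eq hu hv hi, show ((r + 1 : ℕ) : ℤ) - 1 - (r + 1 : ℕ) = -1 by ring, mul_assoc]
  erw [h1]
  rw [show 2 * r + 1 + 1 = 2 * (r + 1) by ring, ← coefA_mul_coefA]
  ring

/-! ### The relations satisfied by the canonical `L` -/

omit hu hv in
-- This is the first entry of the row times the adjugate of `M_{n-1} ⋯ M_0`. In `K M_{2k-1} ⋯ M_0`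
-- the last `n` factors meet their adjugate and leave the determinant; `key` proves this for the
-- partial products, starting from `m = n`.
lemma det_dvd_canon {k n : ℕ} (hn : n ≤ 2 * k) (p : ℂ) :
    ∏ h ∈ range n, (1 - C (u h * v h) * X) ∣
      canonA k u v p * evenPoly n v u - X * canonB k u v p * oddPoly n v u := by
  have key : ∀ m, n ≤ m → ∏ h ∈ range n, (1 - C (u h * v h) * X) ∣
        evenPoly m u v * evenPoly n v u - X * oddPoly m u v * oddPoly n v u ∧
      ∏ h ∈ range n, (1 - C (u h * v h) * X) ∣
        oddPoly m v u * evenPoly n v u - evenPoly m v u * oddPoly n v u := by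
    intro m hm
    induction m, hm using Nat.le_induction with
    | base =>
      rw [← det_rowPoly]
      exact ⟨dvd_rfl, by rw [mul_comm (oddPoly n v u), sub_self]; exact dvd_zero _⟩
    | succ m _ ih =>
      obtain ⟨h1, h2⟩ := ih
      simp only [evenPoly_succ, oddPoly_succ]
      constructor
      · convert dvd_add h1 (h2.mul_left (C (u m) * X)) using 1
        ring
      · convert dvd_add h2 (h1.mul_left (C (v m))) using 1
        ring
  obtain ⟨h1, h2⟩ := key _ hn
  convert dvd_add h1 (h2.mul_left (C p * X)) using 1
  rw [canonA, canonB]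
  ring

lemma canon_eval_eq {k n h : ℕ} (hn : n ≤ 2 * k) (hh : h ∈ range n) (p : ℂ) :
    (canonA k u v p).eval (u h * v h)⁻¹ * (evenPoly n v u).eval (u h * v h)⁻¹
      = (u h * v h)⁻¹ * (canonB k u v p).eval (u h * v h)⁻¹
        * (oddPoly n v u).eval (u h * v h)⁻¹ := by
  obtain ⟨q, hq⟩ := det_dvd_canon (u := u) (v := v) hn p
  have := congrArg (eval (u h * v h)⁻¹) hq
  rw [eval_mul (q := q), eval_prod, prod_eq_zero hh] at this
  · simp only [eval_sub, eval_mul, eval_X] at this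
    linear_combination this
  · have := mul_ne_zero (hu h) (hv h)
    simp only [eval_sub, eval_mul, eval_X, eval_C, eval_one]
    rw [mul_inv_cancel₀ this, sub_self]

/-- After summation over `j` the contribution of each node `w_h` is a multiple of `canon_eval_eq`
with `n = 2 * i + 1`. -/
lemma canon_relation_even {k i : ℕ} (hi : i < k) (p : ℂ) :
    ∑ j ∈ range (k + 1), (coefS i j u v * (canonA k u v p).coeff j
      + coefT i j u v * (canonB k u v p).coeff j) = 0 := by
  have hw := fun h => mul_ne_zero (hu h) (hv h)
  simp only [coefS_eq hu hv, coefT_eq hu hv, mul_assoc, sum_add_distrib, ← mul_sum]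
  rw [sum_lagrangeSum_mul_coeff _ hw _ _ (natDegree_canonA_le k u v p),
    sum_lagrangeSum_mul_coeff _ hw _ _ (natDegree_canonB_le k u v p), neg_mul, ← mul_neg,
    ← mul_add, ← sum_neg_distrib, ← sum_add_distrib, sum_eq_zero, mul_zero]
  intro h hh
  have h1 := canon_eval_eq hu hv (k := k) (by omega) hh p
  rw [eval_reversePoly (natDegree_evenPoly_le (by omega) _ _) (hw h),
    eval_reversePoly (natDegree_oddPoly_le (by omega) _ _) (hw h), zpow_sub₀ (hw h), zpow_one,
    zpow_natCast, ← neg_div, ← add_div]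
  convert zero_div _
  linear_combination -(u h * v h) ^ i * (u h * v h) ^ i * h1

lemma canon_relation_odd {k i : ℕ} (h1i : 1 ≤ i) (hi : i < k) (p : ℂ) :
    ∑ j ∈ range (k + 1), (coefQ i j u v * (canonA k u v p).coeff j
      + coefR i j u v * (canonB k u v p).coeff j) = 0 := by
  have hw := fun h => mul_ne_zero (hu h) (hv h)
  simp only [coefQ_eq hu hv h1i, coefR_eq hu hv h1i, mul_assoc, sum_add_distrib, ← mul_sum]
  rw [sum_lagrangeSum_mul_coeff _ hw _ _ (natDegree_canonA_le k u v p),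
    sum_lagrangeSum_mul_coeff _ hw _ _ (natDegree_canonB_le k u v p), neg_mul, ← mul_neg,
    ← mul_add, ← sum_neg_distrib, ← sum_add_distrib, sum_eq_zero, mul_zero]
  intro h hh
  have h1 := canon_eval_eq hu hv (k := k) (by omega) hh p
  rw [eval_reversePoly (natDegree_evenPoly_le (by omega) _ _) (hw h),
    eval_reversePoly (natDegree_X_mul_oddPoly_le _ _ _) (hw h), eval_mul, eval_X,
    ← neg_div, ← add_div]
  convert zero_div _
  linear_combination -(u h * v h) ^ i * (u h * v h) ^ ((i : ℤ) - 1) * h1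

end

/-! ### The linear system -/

/-- The `[1,1]` element of the `(p, q)` block of `Z_k`. -/
def zScalar (p q : ℕ) (u v : ℕ → ℂ) : ℂ :=
  if q < p then 0
  else if p = q then 1
  else if p % 2 = 0 then
    if q % 2 = 1 then coefS (p / 2) ((q + 1) / 2) u v else coefT (p / 2) (q / 2) u v
  else
    if q = p + 1 then coefP ((p + 1) / 2) u v
    else if q % 2 = 1 then coefQ ((p + 1) / 2) ((q + 1) / 2) u v
    else coefR ((p + 1) / 2) (q / 2) u v

lemma Zblock_eq (u v : ℕ → ℂ) (p q : ℕ) : Zblock u v p q = diagSym (zScalar p q) u v := by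
  unfold Zblock
  split_ifs <;> ext i j <;> fin_cases i <;> fin_cases j <;> simp [diagSym, zScalar, *]

/-- The first component of the `p`-th block of `C_k`. -/
def cScalar (k p : ℕ) (u v : ℕ → ℂ) (w : ℂ) : ℂ :=
  if p % 2 = 0 then coefB (p / 2) u v - coefT (p / 2) k u v * w
  else if (p + 1) / 2 < k then coefA ((p + 1) / 2) u v - coefR ((p + 1) / 2) k u v * w
  else coefA k u v - coefP k u v * w

lemma Cblock_eq (k p : ℕ) (u v : ℕ → ℂ) (w : Fin 2 → ℂ) :
    Cblock k u v w p = ![cScalar k p u v (w 0), cScalar k p v u (w 1)] := by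
  unfold Cblock cScalar
  split_ifs <;> ext i <;> fin_cases i <;>
    simp [diagSym, vecSym, dotProduct, Fin.sum_univ_two]

lemma sum_range_two_mul (f : ℕ → ℂ) (k : ℕ) :
    ∑ q ∈ range (2 * k), f q = ∑ j ∈ range k, (f (2 * j) + f (2 * j + 1)) := by
  induction k with
  | zero => simp
  | succ k ih =>
    rw [show 2 * (k + 1) = 2 * k + 1 + 1 by ring, sum_range_succ, sum_range_succ, ih,
      sum_range_succ, add_assoc]

lemma Zmat_mulVec (k : ℕ) (u v : ℕ → ℂ) (Ψ : Fin (2 * k) × Fin 2 → ℂ) (p : Fin (2 * k)) :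
    (Zmat k u v *ᵥ Ψ) (p, 0) = ∑ q : Fin (2 * k), zScalar p q u v * Ψ (q, 0) ∧
      (Zmat k u v *ᵥ Ψ) (p, 1) = ∑ q : Fin (2 * k), zScalar p q v u * Ψ (q, 1) := by
  simp [mulVec, dotProduct, Zmat, Fintype.sum_prod_type, Zblock_eq, diagSym]

lemma Zmat_blockTriangular (k : ℕ) (u v : ℕ → ℂ) : (Zmat k u v).BlockTriangular Prod.fst := by
  intro p q h
  have h' : q.1 < p.1 := h
  simp [Zmat, Zblock, h']

lemma det_Zmat (k : ℕ) (u v : ℕ → ℂ) : (Zmat k u v).det = 1 := by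
  rw [(Zmat_blockTriangular k u v).det_fintype]
  refine prod_eq_one fun p _ => ?_
  have h : (Zmat k u v).toSquareBlock Prod.fst p = 1 := by
    ext ⟨⟨p₁, s⟩, h₁⟩ ⟨⟨p₂, t⟩, h₂⟩
    simp only at h₁ h₂
    subst h₁ h₂
    simp [toSquareBlock_def, Zmat, Zblock, one_apply]
  rw [h, det_one]

lemma existsUnique_Zmat_mulVec (k : ℕ) (u v : ℕ → ℂ) (w : Fin (2 * k) × Fin 2 → ℂ) :
    ∃! Ψ, Zmat k u v *ᵥ Ψ = w := by
  have h : IsUnit (Zmat k u v).det := by rw [det_Zmat]; exact isUnit_one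
  refine ⟨(Zmat k u v)⁻¹ *ᵥ w, by simp [mul_nonsing_inv _ h], ?_⟩
  rintro Ψ rfl
  simp [nonsing_inv_mul _ h]

section
variable {u v : ℕ → ℂ} (hu : ∀ h, u h ≠ 0) (hv : ∀ h, v h ≠ 0)

/-- Condition (D) covers the indices up to `2 * k - 2`, which are the nodes of all rows except the
last; that row needs none. -/
lemma injOn_of_distinct {k n : ℕ} {w : ℕ → ℂ}
    (hw : ∀ g h, g < h → h + 2 ≤ 2 * k → w g ≠ w h) (hn : n + 1 ≤ 2 * k) :
    Set.InjOn w (range n) := by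
  intro g hg h hh hgh
  rw [mem_coe, mem_range] at hg hh
  rcases lt_trichotomy g h with hlt | heq | hlt
  · exact absurd hgh (hw _ _ hlt (by omega))
  · exact heq
  · exact absurd hgh.symm (hw _ _ hlt (by omega))

include hu hv

/-- The coefficients of the canonical `L` solve the linear system. -/
lemma sum_zScalar_mul_canon {k p : ℕ}
    (hw : ∀ g h, g < h → h + 2 ≤ 2 * k → u g * v g ≠ u h * v h) (hp : p < 2 * k) (r : ℂ) :
    ∑ j ∈ range k, (zScalar p (2 * j) u v * (canonB k u v r).coeff j
        + zScalar p (2 * j + 1) u v * (canonA k u v r).coeff (j + 1))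
      = cScalar k p u v ((canonB k u v r).coeff k) := by
  rcases Nat.even_or_odd' p with ⟨i, rfl | rfl⟩
  · have hinj : Set.InjOn (fun h => u h * v h) (range (2 * i + 1)) :=
      injOn_of_distinct hw (by omega)
    -- The zeros and ones prescribed in `Z_k` are the true values of `T_i^{(j)}` for `j ≤ i`, so one
    -- formula covers the whole row.
    have h1 : ∀ j, zScalar (2 * i) (2 * j) u v = coefT i j u v := by
      intro j
      unfold zScalar
      rcases lt_trichotomy j i with h | rfl | h
      · rw [if_pos (by omega), coefT_of_lt hu hv hinj h]
      · rw [if_neg (by omega), if_pos rfl, coefT_self hu hv hinj]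
      · rw [if_neg (by omega), if_neg (by omega), if_pos (by omega), if_neg (by omega),
          Nat.mul_div_cancel_left _ two_pos, Nat.mul_div_cancel_left _ two_pos]
    have h2 : ∀ j, zScalar (2 * i) (2 * j + 1) u v = coefS i (j + 1) u v := by
      intro j
      unfold zScalar
      rcases Nat.lt_or_ge j i with h | h
      · rw [if_pos (by omega), coefS_of_le hu hv hinj (by omega) (by omega)]
      · rw [if_neg (by omega), if_neg (by omega), if_pos (by omega), if_pos (by omega),
          Nat.mul_div_cancel_left _ two_pos, show (2 * j + 1 + 1) / 2 = j + 1 by omega]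
    have h3 := canon_relation_even hu hv (k := k) (i := i) (by omega) r
    -- The terms with `a_0 = 1` and with `b_k` are split off; they form the right-hand side.
    rw [sum_add_distrib, sum_range_succ', sum_range_succ, coefS_zero hu hv hinj,
      canonA_coeff_zero] at h3
    simp only [h1, h2]
    rw [sum_add_distrib, cScalar, if_pos (by omega), Nat.mul_div_cancel_left _ two_pos]
    linear_combination h3
  · by_cases hik : i + 1 < k
    · have hinj : Set.InjOn (fun h => u h * v h) (range (2 * (i + 1))) :=
        injOn_of_distinct hw (by omega)
      have h1 : ∀ j, zScalar (2 * i + 1) (2 * j) u v = coefR (i + 1) j u v := by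
        intro j
        unfold zScalar
        rcases lt_trichotomy j (i + 1) with h | rfl | h
        · rw [if_pos (by omega), coefR_of_lt hu hv hinj h]
        · rw [if_neg (by omega), if_neg (by omega), if_neg (by omega), if_pos (by omega),
            coefR_self hu hv (by omega) hinj, show (2 * i + 1 + 1) / 2 = i + 1 by omega]
        · rw [if_neg (by omega), if_neg (by omega), if_neg (by omega), if_neg (by omega),
            if_neg (by omega), Nat.mul_div_cancel_left _ two_pos,
            show (2 * i + 1 + 1) / 2 = i + 1 by omega]
      have h2 : ∀ j, zScalar (2 * i + 1) (2 * j + 1) u v = coefQ (i + 1) (j + 1) u v := by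
        intro j
        unfold zScalar
        rcases lt_trichotomy j i with h | rfl | h
        · rw [if_pos (by omega), coefQ_of_lt hu hv hinj (by omega) (by omega)]
        · rw [if_neg (by omega), if_pos rfl, coefQ_self hu hv (by omega) hinj]
        · rw [if_neg (by omega), if_neg (by omega), if_neg (by omega), if_neg (by omega),
            if_pos (by omega), show (2 * i + 1 + 1) / 2 = i + 1 by omega,
            show (2 * j + 1 + 1) / 2 = j + 1 by omega]
      have h3 := canon_relation_odd hu hv (k := k) (i := i + 1) (by omega) hik r
      rw [sum_add_distrib, sum_range_succ', sum_range_succ, coefQ_zero hu hv (by omega) hinj,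
        canonA_coeff_zero] at h3
      simp only [h1, h2]
      rw [sum_add_distrib, cScalar, if_neg (by omega), show (2 * i + 1 + 1) / 2 = i + 1 by omega,
        if_pos hik]
      linear_combination h3
    -- The last row has only its diagonal entry and is the formula for the top coefficient `a_k`.
    · obtain rfl : k = i + 1 := by omega
      rw [sum_range_succ, sum_eq_zero, cScalar, if_neg (by omega), if_neg (by omega),
        ← canonA_coeff_top _ hu hv, zScalar, if_pos (by omega), zScalar, if_neg (by omega),
        if_pos rfl]
      · ring
      · intro j hj
        have := mem_range.1 hj
        rw [zScalar, if_pos (by omega), zScalar, if_pos (by omega)]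
        ring

end

/-! ### Transport along the lattice -/

section
variable {S : Type*}

/-- The orbit of `s` under the steps `T m` from `m` to `m + 1`. -/
def transport (T : ℤ → Equiv.Perm S) (s : S) : ℤ → S
  | Int.ofNat n => Nat.rec s (fun n z => T n z) n
  | Int.negSucc n => Nat.rec ((T (-1)).symm s) (fun n z => (T (Int.negSucc (n + 1))).symm z) n

lemma transport_add_one (T : ℤ → Equiv.Perm S) (s : S) (m : ℤ) :
    transport T s (m + 1) = T m (transport T s m) := by
  rcases m with n | n
  · rfl
  · rcases n with _ | n
    · exact ((T (-1)).apply_symm_apply s).symm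
    · exact ((T (Int.negSucc (n + 1))).apply_symm_apply (transport T s (Int.negSucc n))).symm

/-- Consistent steps in two directions have a common orbit. -/
lemma exists_lattice_orbit [Nonempty S] (A B : ℤ → ℤ → Equiv.Perm S)
    (h : ∀ l m s, A (l + 1) m (B l m s) = B l (m + 1) (A l m s)) :
    ∃ z : ℤ → ℤ → S, (∀ l m, z l (m + 1) = A l m (z l m)) ∧ ∀ l m, z (l + 1) m = B l m (z l m) := by
  obtain ⟨s⟩ := ‹Nonempty S›
  refine ⟨fun l => transport (A l) (transport (fun l => B l 0) s l),
    fun l m => transport_add_one _ _ _, fun l m => ?_⟩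
  induction m using Int.induction_on with
  | zero => exact transport_add_one (fun l => B l 0) s l
  | succ m ih =>
    beta_reduce at ih ⊢
    rw [transport_add_one (A (l + 1)), ih, h, transport_add_one (A l)]
  | pred m ih =>
    beta_reduce at ih ⊢
    apply (A (l + 1) (-m - 1)).injective
    rw [h, ← transport_add_one, ← transport_add_one, sub_add_cancel]
    exact ih

end

/-- The step `(x, y) ↦ (y / a, x / b)`. -/
def swapDiv (a b : ℂˣ) : Equiv.Perm (ℂˣ × ℂˣ) where
  toFun z := (z.2 / a, z.1 / b)
  invFun z := (z.2 * b, z.1 * a)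
  left_inv z := by simp
  right_inv z := by simp

/-- The two relations say that the two `swapDiv` steps commute around every lattice square. Working
in `ℂˣ` makes the steps invertible, so the orbit extends in all directions and never vanishes. -/
lemma exists_potentials {β γ b c : Field2} (hβ : NowhereZero β) (hγ : NowhereZero γ)
    (hb : NowhereZero b) (hc : NowhereZero c)
    (h1 : ∀ l m, γ l m * b l (m + 1) = β (l + 1) m * c l m)
    (h2 : ∀ l m, β l m * c l (m + 1) = γ (l + 1) m * b l m) :
    ∃ x y : Field2, NowhereZero x ∧ NowhereZero y ∧ β = betaOf x y ∧ γ = gammaOf x y ∧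
      b = topB x y ∧ c = topC x y := by
  obtain ⟨z, hA, hB⟩ := exists_lattice_orbit
    (fun l m => swapDiv (Units.mk0 _ (hβ l m)) (Units.mk0 _ (hγ l m)))
    (fun l m => swapDiv (Units.mk0 _ (hb l m)) (Units.mk0 _ (hc l m)))
    (by
      intro l m s
      have hβ' := hβ l m
      have hγ' := hγ l m
      have hb' := hb l (m + 1)
      have hc' := hc l (m + 1)
      have e1 := h1 l m
      have e2 := h2 l m
      ext
      · simp only [swapDiv, Equiv.coe_fn_mk, Units.val_div_eq_div_val, Units.val_mk0]
        rw [div_div, div_div, e1, mul_comm]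
      · simp only [swapDiv, Equiv.coe_fn_mk, Units.val_div_eq_div_val, Units.val_mk0]
        rw [div_div, div_div, e2, mul_comm])
  have key : ∀ (p r : ℂˣ) (a : ℂ) (ha : a ≠ 0), r = p / Units.mk0 a ha → a = (p : ℂ) / r := by
    rintro p r a ha rfl
    simp
  refine ⟨fun l m => (z l m).1, fun l m => (z l m).2, fun l m => Units.ne_zero _,
    fun l m => Units.ne_zero _, ?_, ?_, ?_, ?_⟩ <;> funext l m
  · exact key _ _ _ (hβ l m) (congrArg Prod.fst (hA l m))
  · exact key _ _ _ (hγ l m) (congrArg Prod.snd (hA l m))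
  · exact key _ _ _ (hb l m) (congrArg Prod.fst (hB l m))
  · exact key _ _ _ (hc l m) (congrArg Prod.snd (hB l m))

/-- Compare coefficients of `X ^ (k + 1)` in the `[1,1]` entry, where `a` and `a'` do not
contribute. -/
lemma PolyCompat.coeff_top {k : ℕ} {β γ B Γ : ℂ} {a b c d a' b' c' d' : ℂ[X]}
    (h : PolyCompat β γ B Γ a b c d a' b' c' d') (ha : a.natDegree ≤ k) (ha' : a'.natDegree ≤ k) :
    γ * b'.coeff k = B * c.coeff k := by
  have := congrArg (fun p => p.coeff (k + 1)) h.e11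
  simpa [mul_assoc, coeff_eq_zero_of_natDegree_lt (Nat.lt_succ_of_le ha),
    coeff_eq_zero_of_natDegree_lt (Nat.lt_succ_of_le ha')] using this

theorem parametrisation {k : ℕ} {β γ : Field2} {L : LaxCoeffs k} (hβ : NowhereZero β)
    (hγ : NowhereZero γ) (hb : NowhereZero (L.b (Fin.last k)))
    (hc : NowhereZero (L.c (Fin.last k))) (h : Compatible β γ L) :
    ∃ x y : Field2, NowhereZero x ∧ NowhereZero y ∧ β = betaOf x y ∧ γ = gammaOf x y ∧
      L.b (Fin.last k) = topB x y ∧ L.c (Fin.last k) = topC x y := by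
  rw [compatible_iff] at h
  refine exists_potentials hβ hγ hb hc (fun l m => ?_) (fun l m => ?_)
  · simpa only [← coeff_coeffPoly, Fin.val_last] using
      (h l m).coeff_top (natDegree_coeffPoly_le _ _ _) (natDegree_coeffPoly_le _ _ _)
  · simpa only [← coeff_coeffPoly, Fin.val_last] using
      (h l m).swap.coeff_top (natDegree_coeffPoly_le _ _ _) (natDegree_coeffPoly_le _ _ _)

/-! ### The sheared lattice -/

theorem isSolution_iff_shear (k : ℕ) (x y : Field2) :
    IsSolution k x y ↔ IsLMKdV2 (shear k x) (shear k y) := by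
  -- The base point is the sheared position over `l + 1`; over `l` the same `m` then lies `2 * k`
  -- higher, which produces the shifts in (E_k).
  have key : ∀ l m n : ℤ, m - 2 * k * (l + 1) = n → m - 2 * k * l = n + 2 * k ∧
      m + 1 - 2 * k * l = n + (2 * k + 1) ∧ m + 1 - 2 * k * (l + 1) = n + 1 :=
    fun l m n h => ⟨by linear_combination h, by linear_combination h, by linear_combination h⟩
  constructor
  · intro h l m
    obtain ⟨e1, e2, e3⟩ := key l m _ rfl
    simp only [shear]
    rw [e1, e2, e3]
    exact h l _
  · intro h l m
    have := h l (m + 2 * k * (l + 1))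
    obtain ⟨e1, e2, e3⟩ := key l (m + 2 * k * (l + 1)) m (by ring)
    simp only [shear] at this
    rw [e1, e2, e3, add_sub_cancel_right] at this
    exact this

/-! ### The canonical Lax pair -/

section
variable {x y : Field2}

lemma shifts_add_one (f : Field2) (l m : ℤ) :
    shifts f l (m + 1) = fun h => shifts f l m (h + 1) := by
  funext h
  simp only [shifts]
  congr 1
  push_cast
  ring

lemma shifts_betaOf_ne_zero (hx : NowhereZero x) (hy : NowhereZero y) (l m : ℤ) (h : ℕ) :
    shifts (betaOf x y) l m h ≠ 0 := div_ne_zero (hy _ _) (hx _ _)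

lemma shifts_gammaOf_ne_zero (hx : NowhereZero x) (hy : NowhereZero y) (l m : ℤ) (h : ℕ) :
    shifts (gammaOf x y) l m h ≠ 0 := div_ne_zero (hx _ _) (hy _ _)

/-- The entry `p` of the left factor `K = [[1, p ν], [q ν, 1]]` of the canonical `L`. -/
def leftEntry (k : ℕ) (x y : Field2) (l m : ℤ) : ℂ := y l (m + 2 * k) / x (l + 1) m

/-- The coefficients of `K M_{2k-1} ⋯ M_0`. -/
def canonLax (k : ℕ) (x y : Field2) : LaxCoeffs k where
  a i l m := (canonA k (shifts (betaOf x y) l m) (shifts (gammaOf x y) l m)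
    (leftEntry k x y l m)).coeff i
  b i l m := (canonB k (shifts (betaOf x y) l m) (shifts (gammaOf x y) l m)
    (leftEntry k x y l m)).coeff i
  c i l m := (canonB k (shifts (gammaOf x y) l m) (shifts (betaOf x y) l m)
    (leftEntry k y x l m)).coeff i
  d i l m := (canonA k (shifts (gammaOf x y) l m) (shifts (betaOf x y) l m)
    (leftEntry k y x l m)).coeff i

lemma coefA_shifts (i : ℕ) (hx : NowhereZero x) (hy : NowhereZero y) (l m : ℤ) :
    coefA i (shifts (betaOf x y) l m) (shifts (gammaOf x y) l m) = x l m / x l (m + 2 * i) := by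
  induction i with
  | zero => simp [coefA, hx l m]
  | succ i ih =>
    rw [coefA, prod_range_succ, ← coefA, ih]
    simp only [shifts, betaOf, gammaOf]
    rw [show m + ((2 * i : ℕ) : ℤ) = m + 2 * i by push_cast; ring,
      show m + ((2 * i + 1 : ℕ) : ℤ) = m + 2 * i + 1 by push_cast; ring,
      show m + 2 * ((i + 1 : ℕ) : ℤ) = m + 2 * i + 1 + 1 by push_cast; ring]
    have h1 := hx l (m + 2 * i)
    have h2 := hy l (m + 2 * i + 1)
    field_simp

lemma coefA_shifts_swap (i : ℕ) (hx : NowhereZero x) (hy : NowhereZero y) (l m : ℤ) :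
    coefA i (shifts (gammaOf x y) l m) (shifts (betaOf x y) l m) = y l m / y l (m + 2 * i) :=
  coefA_shifts i hy hx l m

lemma canonB_top (k : ℕ) (hx : NowhereZero x) (hy : NowhereZero y) (l m : ℤ) :
    (canonB k (shifts (betaOf x y) l m) (shifts (gammaOf x y) l m) (leftEntry k x y l m)).coeff k
      = topB x y l m := by
  rw [canonB_coeff_top, coefA_shifts_swap k hx hy, leftEntry, topB]
  have := hy l (m + 2 * k)
  field_simp

lemma canonB_top_swap (k : ℕ) (hx : NowhereZero x) (hy : NowhereZero y) (l m : ℤ) :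
    (canonB k (shifts (gammaOf x y) l m) (shifts (betaOf x y) l m) (leftEntry k y x l m)).coeff k
      = topC x y l m := canonB_top k hy hx l m

lemma canonLax_admissible (k : ℕ) (hx : NowhereZero x) (hy : NowhereZero y) :
    Admissible x y (canonLax k x y) where
  a_zero _ _ := canonA_coeff_zero _ _ _ _
  d_zero _ _ := canonA_coeff_zero _ _ _ _
  b_top := by funext l m; exact canonB_top k hx hy l m
  c_top := by funext l m; exact canonB_top k hy hx l m

lemma coefP_shifts_mul (k : ℕ) (hx : NowhereZero x) (hy : NowhereZero y) (l m : ℤ) :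
    coefP k (shifts (betaOf x y) l m) (shifts (gammaOf x y) l m) * topB x y l m
      = -(x l m / x (l + 1) m * ∑ j ∈ Icc 1 k, (y l (m + 2 * j) / y l (m + 2 * j - 1)
        + x l (m + 2 * j - 1) / x l (m + 2 * j - 2))) := by
  rw [coefP, neg_mul, neg_inj, show Icc 1 k = Ico 1 (k + 1) by ext; simp,
    sum_Ico_eq_sum_range, Nat.add_sub_cancel, sum_mul, mul_sum]
  refine sum_congr rfl fun j _ => ?_
  rw [mul_assoc (_ + 1), inv_mul_prod, coefA_shifts j hx hy, coefA_shifts_swap j hx hy]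
  simp only [shifts, betaOf, gammaOf, topB]
  rw [show m + ((2 * j : ℕ) : ℤ) = m + 2 * j by push_cast; ring,
    show m + ((2 * j + 1 : ℕ) : ℤ) = m + 2 * j + 1 by push_cast; ring,
    show m + 2 * ((1 + j : ℕ) : ℤ) = m + 2 * j + 1 + 1 by push_cast; ring,
    show m + 2 * j + 1 + 1 - 2 = m + 2 * (j : ℤ) by ring, add_sub_cancel_right]
  have h1 := hx l (m + 2 * j)
  have h2 := hy l (m + 2 * j + 1)
  have h3 := hx l (m + 2 * j + 1)
  have h4 := hy l (m + 2 * j)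
  have h5 := hy l m
  have h6 := hy l (m + 2 * j + 1 + 1)
  have h7 := hx (l + 1) m
  field_simp

lemma canonA_top (k : ℕ) (hx : NowhereZero x) (hy : NowhereZero y) (l m : ℤ) :
    (canonA k (shifts (betaOf x y) l m) (shifts (gammaOf x y) l m) (leftEntry k x y l m)).coeff k
      = topA k x y l m := by
  rw [canonA_coeff_top k (shifts_betaOf_ne_zero hx hy l m) (shifts_gammaOf_ne_zero hx hy l m),
    canonB_top k hx hy, coefP_shifts_mul k hx hy, coefA_shifts k hx hy, topA, sub_neg_eq_add]

lemma canonLax_topA (k : ℕ) (hx : NowhereZero x) (hy : NowhereZero y) :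
    (canonLax k x y).a (Fin.last k) = topA k x y ∧ (canonLax k x y).d (Fin.last k) = topA k y x :=
  ⟨by funext l m; exact canonA_top k hx hy l m, by funext l m; exact canonA_top k hy hx l m⟩

lemma canon_step_iff {x₁ x₂ y₁ y₂ y₃ z : ℂ} (hz : z ≠ 0) (hx₁ : x₁ ≠ 0) (hx₂ : x₂ ≠ 0)
    (hy₁ : y₁ ≠ 0) :
    y₁ / x₁ + y₂ / z = y₁ / x₂ + y₃ / z ↔ z / x₁ + y₂ / y₁ = z / x₂ + y₃ / y₁ := by
  have e : ∀ c w : ℂ, c ≠ 0 → z / c + w / y₁ = z / y₁ * (y₁ / c + w / z) := by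
    intro c w hc
    field_simp
  rw [e _ _ hx₁, e _ _ hx₂, mul_right_inj' (div_ne_zero hz hy₁)]

/-- The off-diagonal entries of `K̂ M_{2k} = M̄ K` are (E_k) up to the nonzero factor in
`canon_step_iff`; the diagonal entries agree by the choice of `leftEntry`. -/
lemma canonLax_compatible_iff (k : ℕ) (hx : NowhereZero x) (hy : NowhereZero y) :
    Compatible (betaOf x y) (gammaOf x y) (canonLax k x y) ↔ IsSolution k x y := by
  rw [compatible_iff]
  refine forall₂_congr fun l m => ?_
  have ha : ∀ m, coeffPoly (canonLax k x y).a l m = _ := fun m =>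
    coeffPoly_eq (natDegree_canonA_le k (shifts (betaOf x y) l m) (shifts (gammaOf x y) l m)
      (leftEntry k x y l m)) fun _ => rfl
  have hb : ∀ m, coeffPoly (canonLax k x y).b l m = _ := fun m =>
    coeffPoly_eq (natDegree_canonB_le k (shifts (betaOf x y) l m) (shifts (gammaOf x y) l m)
      (leftEntry k x y l m)) fun _ => rfl
  have hc : ∀ m, coeffPoly (canonLax k x y).c l m = _ := fun m =>
    coeffPoly_eq (natDegree_canonB_le k (shifts (gammaOf x y) l m) (shifts (betaOf x y) l m)
      (leftEntry k y x l m)) fun _ => rfl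
  have hd : ∀ m, coeffPoly (canonLax k x y).d l m = _ := fun m =>
    coeffPoly_eq (natDegree_canonA_le k (shifts (gammaOf x y) l m) (shifts (betaOf x y) l m)
      (leftEntry k y x l m)) fun _ => rfl
  rw [ha, ha, hb, hb, hc, hc, hd, hd, shifts_add_one, shifts_add_one,
    show betaOf x y l m = shifts (betaOf x y) l m 0 by simp [shifts],
    show gammaOf x y l m = shifts (gammaOf x y) l m 0 by simp [shifts]]
  have e1 : m + 1 + 2 * (k : ℤ) = m + (2 * k + 1) := by ring
  have e2 : m + ((2 * k : ℕ) : ℤ) = m + 2 * k := by push_cast; ring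
  have e3 : m + 2 * (k : ℤ) + 1 = m + (2 * k + 1) := by ring
  rw [polyCompat_canon_iff]
  · simp only [leftEntry, shifts, betaOf, gammaOf, e1, e2, e3]
    rw [canon_step_iff (hx _ _) (hx _ _) (hx _ _) (hy _ _),
      canon_step_iff (hy _ _) (hy _ _) (hy _ _) (hx _ _)]
  · simp only [leftEntry, shifts, betaOf, gammaOf, e1, e2, e3]
    have := hy l (m + (2 * k + 1))
    have := hy (l + 1) m
    field_simp
  · simp only [leftEntry, shifts, betaOf, gammaOf, e1, e2, e3]
    have := hx l (m + (2 * k + 1))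
    have := hx (l + 1) m
    field_simp

/-- Condition (G) allows `2 * k` right divisions by shifts of `M`; `eq_canon` then treats the two
rows separately. -/
lemma eq_canonLax {k : ℕ} (hx : NowhereZero x) (hy : NowhereZero y) {L : LaxCoeffs k}
    (hG : NonResonant k (betaOf x y) (gammaOf x y)) (hL : IsLaxPair x y L) :
    L = canonLax k x y := by
  obtain ⟨hadm, hcomp⟩ := hL
  rw [compatible_iff] at hcomp
  have key : ∀ l m,
      (coeffPoly L.a l m = canonA k (shifts (betaOf x y) l m) (shifts (gammaOf x y) l m)
        (leftEntry k x y l m) ∧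
      coeffPoly L.b l m = canonB k (shifts (betaOf x y) l m) (shifts (gammaOf x y) l m)
        (leftEntry k x y l m)) ∧
      (coeffPoly L.d l m = canonA k (shifts (gammaOf x y) l m) (shifts (betaOf x y) l m)
        (leftEntry k y x l m) ∧
      coeffPoly L.c l m = canonB k (shifts (gammaOf x y) l m) (shifts (betaOf x y) l m)
        (leftEntry k y x l m)) := by
    intro l m
    obtain ⟨e, f, g, s, h1, h2, h3, h4⟩ := exists_right_quotient (2 * k)
      (fun m => div_ne_zero (hy l m) (hx l (m + 1))) (fun m => div_ne_zero (hx l m) (hy l (m + 1)))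
      (fun m => hcomp l m) (fun m h hh => hG l m h hh) m
    have hu := shifts_betaOf_ne_zero hx hy l m
    have hv := shifts_gammaOf_ne_zero hx hy l m
    refine ⟨eq_canon hu hv h1 h2 (natDegree_coeffPoly_le _ _ _) (natDegree_coeffPoly_le _ _ _)
        ?_ ?_,
      eq_canon hv hu h3 h4 (natDegree_coeffPoly_le _ _ _) (natDegree_coeffPoly_le _ _ _) ?_ ?_⟩
    · exact (coeff_coeffPoly L.a l m 0).trans (hadm.a_zero l m)
    · refine (coeff_coeffPoly L.b l m (Fin.last k)).trans ?_
      rw [hadm.b_top, ← canonB_top k hx hy, canonB_coeff_top]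
    · exact (coeff_coeffPoly L.d l m 0).trans (hadm.d_zero l m)
    · refine (coeff_coeffPoly L.c l m (Fin.last k)).trans ?_
      rw [hadm.c_top, ← canonB_top_swap k hx hy, canonB_coeff_top]
  ext i l m
  · rw [← coeff_coeffPoly L.a, (key l m).1.1]; rfl
  · rw [← coeff_coeffPoly L.b, (key l m).1.2]; rfl
  · rw [← coeff_coeffPoly L.c, (key l m).2.2]; rfl
  · rw [← coeff_coeffPoly L.d, (key l m).2.1]; rfl

/-- The canonical `L` solves the linear system. -/
lemma canonLax_reconstructed {k : ℕ} (hx : NowhereZero x) (hy : NowhereZero y)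
    (hD : ShiftDistinct k (betaOf x y) (gammaOf x y)) : Reconstructed x y (canonLax k x y) := by
  intro l m
  have hu := shifts_betaOf_ne_zero hx hy l m
  have hv := shifts_gammaOf_ne_zero hx hy l m
  -- Stated for general `u, v`, so that the second component follows by interchanging `β` and `γ`.
  have row : ∀ (u v : ℕ → ℂ), (∀ h, u h ≠ 0) → (∀ h, v h ≠ 0) →
      (∀ g h, g < h → h + 2 ≤ 2 * k → u g * v g ≠ u h * v h) → ∀ (r : ℂ) (p : Fin (2 * k)),
      ∑ q : Fin (2 * k), zScalar p q u v * (if (q : ℕ) % 2 = 0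
        then (canonB k u v r).coeff (((q : ℕ) + 1) / 2)
        else (canonA k u v r).coeff (((q : ℕ) + 1) / 2))
        = cScalar k p u v ((canonB k u v r).coeff k) := by
    intro u v hu hv hw r p
    rw [Fin.sum_univ_eq_sum_range (fun q => zScalar p q u v * (if q % 2 = 0
        then (canonB k u v r).coeff ((q + 1) / 2)
        else (canonA k u v r).coeff ((q + 1) / 2))) (2 * k), sum_range_two_mul,
      ← sum_zScalar_mul_canon hu hv hw p.2]
    refine sum_congr rfl fun j _ => ?_
    rw [if_pos (by omega), if_neg (by omega), show (2 * j + 1) / 2 = j by omega,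
      show (2 * j + 1 + 1) / 2 = j + 1 by omega]
  have hD' := hD l m
  funext ⟨p, s⟩
  fin_cases s
  · refine (Zmat_mulVec k _ _ _ p).1.trans ?_
    refine Eq.trans ?_ ((row _ _ hu hv hD' (leftEntry k x y l m) p).trans ?_)
    · refine sum_congr rfl fun q _ => ?_
      simp only [PsiVec]
      split_ifs <;> rfl
    · rw [canonB_top k hx hy]
      simp [Cat, Cvec, Cblock_eq]
  · refine (Zmat_mulVec k _ _ _ p).2.trans ?_
    refine Eq.trans ?_ ((row _ _ hv hu (fun g h hgh hh => by
      simpa only [shifts, mul_comm] using hD' g h hgh hh) (leftEntry k y x l m) p).trans ?_)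
    · refine sum_congr rfl fun q _ => ?_
      simp only [PsiVec]
      split_ifs <;> rfl
    · rw [canonB_top_swap k hx hy]
      simp [Cat, Cvec, Cblock_eq]

/-- The coefficients missing from `Ψ_k` are `a_0, d_0, b_k, c_k`, which are exactly those fixed by
`Admissible`. -/
lemma LaxCoeffs.eq_of_psiVec {k : ℕ} {L L' : LaxCoeffs k} (hL : Admissible x y L)
    (hL' : Admissible x y L') (h : ∀ l m, PsiVec L l m = PsiVec L' l m) : L = L' := by
  have hφ : ∀ (i : Fin (k + 1)) (l m : ℤ), (i : ℕ) < k →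
      L.b i l m = L'.b i l m ∧ L.c i l m = L'.c i l m := by
    intro i l m hi
    have h0 := congrFun (h l m) (⟨2 * i, by omega⟩, 0)
    have h1 := congrFun (h l m) (⟨2 * i, by omega⟩, 1)
    have e : (2 * (i : ℕ) + 1) / 2 = i := by omega
    simp [PsiVec, e] at h0 h1
    exact ⟨h0, h1⟩
  have hψ : ∀ (i : Fin (k + 1)) (l m : ℤ), 0 < (i : ℕ) →
      L.a i l m = L'.a i l m ∧ L.d i l m = L'.d i l m := by
    intro i l m hi
    have h0 := congrFun (h l m) (⟨2 * i - 1, by omega⟩, 0)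
    have h1 := congrFun (h l m) (⟨2 * i - 1, by omega⟩, 1)
    have e : (2 * (i : ℕ) - 1 + 1) / 2 = i := by omega
    have e' : (2 * (i : ℕ) - 1) % 2 = 1 := by omega
    simp [PsiVec, e, e'] at h0 h1
    exact ⟨h0, h1⟩
  have ha : ∀ (i : Fin (k + 1)) (l m : ℤ), L.a i l m = L'.a i l m ∧ L.d i l m = L'.d i l m := by
    intro i l m
    rcases Nat.eq_zero_or_pos (i : ℕ) with hi | hi
    · obtain rfl : i = 0 := Fin.ext hi
      rw [hL.a_zero, hL'.a_zero, hL.d_zero, hL'.d_zero]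
      exact ⟨rfl, rfl⟩
    · exact hψ i l m hi
  have hb : ∀ (i : Fin (k + 1)) (l m : ℤ), L.b i l m = L'.b i l m ∧ L.c i l m = L'.c i l m := by
    intro i l m
    rcases Nat.lt_or_ge (i : ℕ) k with hi | hi
    · exact hφ i l m hi
    · obtain rfl : i = Fin.last k := Fin.ext (by have := i.2; simp; omega)
      rw [hL.b_top, hL'.b_top, hL.c_top, hL'.c_top]
      exact ⟨rfl, rfl⟩
  ext i l m
  · exact (ha i l m).1
  · exact (hb i l m).1
  · exact (hb i l m).2
  · exact (ha i l m).2

lemma eq_canonLax_of_reconstructed {k : ℕ} (hx : NowhereZero x) (hy : NowhereZero y)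
    (hD : ShiftDistinct k (betaOf x y) (gammaOf x y)) {L : LaxCoeffs k} (hL : Admissible x y L)
    (hrec : Reconstructed x y L) : L = canonLax k x y :=
  LaxCoeffs.eq_of_psiVec hL (canonLax_admissible k hx hy) fun l m =>
    (existsUnique_Zmat_mulVec k _ _ _).unique (hrec l m) (canonLax_reconstructed hx hy hD l m)

end

end LMKdV

end

/-! ### The main theorem -/

theorem mainTheorem2 (k : ℕ) :
    (∀ (β γ : LMKdV.Field2) (X : LMKdV.LaxCoeffs k),
      LMKdV.NowhereZero β → LMKdV.NowhereZero γ →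
      LMKdV.NowhereZero (X.b (Fin.last k)) → LMKdV.NowhereZero (X.c (Fin.last k)) →
      LMKdV.Compatible β γ X →
      ∃ x y : LMKdV.Field2, LMKdV.NowhereZero x ∧ LMKdV.NowhereZero y ∧
        β = LMKdV.betaOf x y ∧ γ = LMKdV.gammaOf x y ∧
        X.b (Fin.last k) = LMKdV.topB x y ∧ X.c (Fin.last k) = LMKdV.topC x y) ∧
    (∀ x y : LMKdV.Field2, LMKdV.NowhereZero x → LMKdV.NowhereZero y →
      -- the system is LMKdV₂ on the sheared lattice
      (LMKdV.IsSolution k x y ↔ LMKdV.IsLMKdV2 (LMKdV.shear k x) (LMKdV.shear k y)) ∧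
      -- a solution of the system has a Lax pair with the stated top coefficients
      (LMKdV.IsSolution k x y → ∃ X : LMKdV.LaxCoeffs k, LMKdV.IsLaxPair x y X ∧
        X.a (Fin.last k) = LMKdV.topA k x y ∧ X.d (Fin.last k) = LMKdV.topA k y x) ∧
      -- generically, the system is equivalent to compatibility, and the Lax pair is unique
      (LMKdV.NonResonant k (LMKdV.betaOf x y) (LMKdV.gammaOf x y) →
        ((∃ X : LMKdV.LaxCoeffs k, LMKdV.IsLaxPair x y X) ↔ LMKdV.IsSolution k x y) ∧
        ∀ X : LMKdV.LaxCoeffs k, LMKdV.IsLaxPair x y X →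
          X.a (Fin.last k) = LMKdV.topA k x y ∧ X.d (Fin.last k) = LMKdV.topA k y x ∧
          ∀ Y : LMKdV.LaxCoeffs k, LMKdV.IsLaxPair x y Y → Y = X) ∧
      -- reconstruction of the Lax pair from the linear system
      (LMKdV.ShiftDistinct k (LMKdV.betaOf x y) (LMKdV.gammaOf x y) →
        (∀ l m, (LMKdV.Zat k x y l m).BlockTriangular Prod.fst ∧
          ∃! Ψ, Matrix.mulVec (LMKdV.Zat k x y l m) Ψ = LMKdV.Cat k x y l m) ∧
        (∃! X : LMKdV.LaxCoeffs k, LMKdV.Admissible x y X ∧ LMKdV.Reconstructed x y X) ∧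
        ∀ X : LMKdV.LaxCoeffs k, LMKdV.Admissible x y X →
          (LMKdV.Reconstructed x y X →
            (LMKdV.Compatible (LMKdV.betaOf x y) (LMKdV.gammaOf x y) X ↔
              LMKdV.IsSolution k x y)) ∧
          (LMKdV.NonResonant k (LMKdV.betaOf x y) (LMKdV.gammaOf x y) →
            LMKdV.Compatible (LMKdV.betaOf x y) (LMKdV.gammaOf x y) X →
            LMKdV.Reconstructed x y X))) := by
  refine ⟨fun β γ L hβ hγ hb hc h => LMKdV.parametrisation hβ hγ hb hc h, fun x y hx hy =>
    ⟨LMKdV.isSolution_iff_shear k x y, fun h => ⟨LMKdV.canonLax k x y,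
      ⟨LMKdV.canonLax_admissible k hx hy, (LMKdV.canonLax_compatible_iff k hx hy).2 h⟩,
      LMKdV.canonLax_topA k hx hy⟩, fun hG => ⟨⟨?_, fun h => ?_⟩, fun L hL => ?_⟩, fun hD => ?_⟩⟩
  · rintro ⟨L, hL⟩
    obtain rfl := LMKdV.eq_canonLax hx hy hG hL
    exact (LMKdV.canonLax_compatible_iff k hx hy).1 hL.2
  · exact ⟨LMKdV.canonLax k x y, LMKdV.canonLax_admissible k hx hy,
      (LMKdV.canonLax_compatible_iff k hx hy).2 h⟩
  · obtain rfl := LMKdV.eq_canonLax hx hy hG hL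
    exact ⟨(LMKdV.canonLax_topA k hx hy).1, (LMKdV.canonLax_topA k hx hy).2,
      fun L' hL' => LMKdV.eq_canonLax hx hy hG hL'⟩
  · have hcan := LMKdV.canonLax_reconstructed hx hy hD
    refine ⟨fun l m => ⟨LMKdV.Zmat_blockTriangular k _ _, LMKdV.existsUnique_Zmat_mulVec k _ _ _⟩,
      ⟨LMKdV.canonLax k x y, ⟨LMKdV.canonLax_admissible k hx hy, hcan⟩,
        fun L hL => LMKdV.eq_canonLax_of_reconstructed hx hy hD hL.1 hL.2⟩,
      fun L hL => ⟨fun hrec => ?_, fun hG hcomp => ?_⟩⟩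
    · obtain rfl := LMKdV.eq_canonLax_of_reconstructed hx hy hD hL hrec
      exact LMKdV.canonLax_compatible_iff k hx hy
    · obtain rfl := LMKdV.eq_canonLax hx hy hG ⟨hL, hcomp⟩
      exact hcan
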